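/- Let $n\ge 2$ be an integer and let $T_n$ be the generalised Thompson group of all orientation-preserving piecewise-linear homeomorphisms of the circle $S^1=[0,1]/(0\sim 1)$ that take some $n$-adic subdivision of $S^1$ to an $n$-adic subdivision, affinely on each subinterval; here an $n$-adic subdivision is one obtained from $[0,1]$ by finitely many times dividing a subinterval into $n$ equal parts, i.e. the leaves of a finite $n$-ary tree. An element of $T_n$ is represented by a cyclically labelled pair of $n$-ary trees (source, target) with the same number of leaves: the leaf interval of the source tree with label $i$ is mapped affinely onto the leaf interval of the target tree with label $i$. A vertex with its $n$ outgoing edges is a caret; the tree pair is reduced if there is no caret in the source tree and caret in the target tree whose edges all end in leaves and whose leaves carry the same labels from left to right. Every $\omega\in T_n$ is represented by a reduced tree pair; let $N(\omega)$ be the number of carets of either tree of a reduced tree pair representing $\omega$. Let $\Sigma=\{x_0,\dots,x_{n-1},c_0\}\subset T_n$, where, for $0\le i\le n-2$, $x_i$ is represented by the source tree consisting of a root caret with a caret attached at its leaf $i$ (leaves are counted from left to right, starting at $0$) and the target tree consisting of a root caret with a caret attached at its last leaf; $x_{n-1}$ is represented by the pair obtained by attaching both trees of the pair of $x_0$ to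 the last leaf of a root caret; in these pairs the leaves of both trees are labelled $0,1,2,\dots$ from left to right. The element $c_0$ is represented by the pair of two single carets with leaves labelled, from left to right, $0,1,\dots,n-1$ in the source and $1,\dots,n-1,0$ in the target. Then $\Sigma$ generates $T_n$, and the word length $|\omega|_\Sigma$ with respect to $\Sigma$ satisfies, for every $\omega\in T_n$, $$\frac{N(\omega)}{3}\le|\omega|_\Sigma\le 15(n-1)N(\omega)+3n .$$ -/

import Mathlib

/-- Finite rooted `n`-ary trees: a leaf, or a caret (a root with `n` ordered children). -/
inductive NTree (n : ℕ) : Type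
  | leaf : NTree n
  | node : (Fin n → NTree n) → NTree n

namespace NTree

variable {n : ℕ}

/-- The leaves of a tree, listed from left to right.  A leaf is given by its address, the list of
children chosen on the way from the root down to it. -/
def leaves : NTree n → List (List (Fin n))
  | leaf => [[]]
  | node c => (List.finRange n).flatMap fun i => (c i).leaves.map (fun w => i :: w)

/-- The number of carets of a tree. -/
def carets : NTree n → ℕ
  | leaf => 0
  | node c => 1 + ∑ i, (c i).carets

/-- A single caret. -/
def caret (n : ℕ) : NTree n := node fun _ => leaf

/-- A root caret with the tree `t` attached at its leaf number `j` (counted from `0`). -/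
def hang (j : ℕ) (t : NTree n) : NTree n := node fun i => if i.val = j then t else leaf

theorem mem_leaves_node {c : Fin n → NTree n} {w : List (Fin n)} :
    w ∈ (node c).leaves ↔ ∃ i, ∃ x ∈ (c i).leaves, w = i :: x := by
  simp [leaves, eq_comm]

theorem length_leaves (hn : 1 ≤ n) (t : NTree n) :
    t.leaves.length = (n - 1) * t.carets + 1 := by
  induction t with
  | leaf => simp [leaves, carets]
  | node c ih =>
    have h : (node c).leaves.length = ∑ i, (c i).leaves.length := by
      simp [leaves, List.length_flatMap, Fin.sum_univ_def]
    rw [h, Finset.sum_congr rfl fun i _ => ih i, Finset.sum_add_distrib, ← Finset.mul_sum]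
    obtain ⟨m, rfl⟩ : ∃ m, n = m + 1 := ⟨n - 1, by omega⟩
    simp only [carets, Finset.sum_const, Finset.card_univ, Fintype.card_fin, smul_eq_mul,
      Nat.add_sub_cancel]
    ring

theorem carets_caret : (caret n).carets = 1 := by
  simp [caret, carets]

theorem carets_hang {j : ℕ} (hj : j < n) (t : NTree n) : (hang j t).carets = 1 + t.carets := by
  have : ∀ i : Fin n, (if i.val = j then t else leaf).carets
      = if i = ⟨j, hj⟩ then t.carets else 0 := by
    intro i
    by_cases h : i.val = j
    · have : i = ⟨j, hj⟩ := Fin.ext h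
      simp [this]
    · have h' : i ≠ ⟨j, hj⟩ := fun e => h (by rw [e])
      simp [h, h', carets]
  simp [hang, carets, this]

/-- Attach the tree `φ u` at every leaf `u` of a tree. -/
def graft : NTree n → (List (Fin n) → NTree n) → NTree n
  | leaf, φ => φ []
  | node c, φ => node fun i => (c i).graft fun w => φ (i :: w)

/-- The subtree below the vertex with a given address (a leaf if there is no such vertex). -/
def sub : NTree n → List (Fin n) → NTree n
  | t, [] => t
  | leaf, _ :: _ => leaf
  | node c, i :: w => (c i).sub w

theorem sub_nil (t : NTree n) : t.sub [] = t := by cases t <;> rfl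

theorem sub_leaf (w : List (Fin n)) : (leaf : NTree n).sub w = leaf := by cases w <;> rfl

theorem mem_leaves_graft {t : NTree n} {φ : List (Fin n) → NTree n} {w : List (Fin n)} :
    w ∈ (t.graft φ).leaves ↔ ∃ u ∈ t.leaves, ∃ x ∈ (φ u).leaves, w = u ++ x := by
  induction t generalizing φ w with
  | leaf => simp [graft, leaves]
  | node c ih =>
    simp only [graft, mem_leaves_node, ih]
    constructor
    · rintro ⟨i, x, ⟨u, hu, y, hy, rfl⟩, rfl⟩
      exact ⟨i :: u, ⟨i, u, hu, rfl⟩, y, hy, rfl⟩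
    · rintro ⟨_, ⟨i, u, hu, rfl⟩, y, hy, rfl⟩
      exact ⟨i, u ++ y, ⟨u, hu, y, hy, rfl⟩, rfl⟩

/-- The common expansion of two trees does not depend on their order. -/
theorem graft_sub_comm (s t : NTree n) : s.graft t.sub = t.graft s.sub := by
  induction s generalizing t with
  | leaf =>
    have h : ∀ t : NTree n, t.graft (fun _ => leaf) = t := by
      intro t
      induction t with
      | leaf => rfl
      | node c ih => simp [graft, ih]
    have h' : (leaf : NTree n).sub = fun _ => leaf := funext sub_leaf
    rw [h', h]
    exact sub_nil t
  | node c ih =>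
    cases t with
    | leaf =>
      have h : ∀ t : NTree n, t.graft (fun _ => leaf) = t := by
        intro t
        induction t with
        | leaf => rfl
        | node c ih => simp [graft, ih]
      have h' : (leaf : NTree n).sub = fun _ => leaf := funext sub_leaf
      rw [h', h]
      rfl
    | node d =>
      simp only [graft]
      congr 1
      funext i
      exact ih i (d i)

end NTree

/-- The left end point of the `n`-adic interval
`[leftEnd w, leftEnd w + (1 / n) ^ w.length] ⊆ [0, 1]` that belongs to the vertex with address `w`:
the root carries `[0, 1]`, and the `n` children of a vertex carry, from left to right, the `n`
equal parts of its interval. -/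
noncomputable def leftEnd {n : ℕ} : List (Fin n) → ℝ
  | [] => 0
  | i :: w => ((i : ℝ) + leftEnd w) / n

/-- The circle `[0, 1] / (0 ∼ 1)`. -/
abbrev UCircle : Type := AddCircle (1 : ℝ)

/-- `f` maps the `n`-adic interval of the address `u` onto the `n`-adic interval of the address
`v` by the orientation-preserving affine map. -/
def MapsAffinely {n : ℕ} (f : UCircle ≃ₜ UCircle) (u v : List (Fin n)) : Prop :=
  ∀ t ∈ Set.Icc (0 : ℝ) 1,
    f ((leftEnd u + t * (1 / (n : ℝ)) ^ u.length : ℝ) : UCircle)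
      = ((leftEnd v + t * (1 / (n : ℝ)) ^ v.length : ℝ) : UCircle)

section Helpers

variable {n : ℕ}

theorem leftEnd_append (u x : List (Fin n)) :
    leftEnd (u ++ x) = leftEnd u + leftEnd x * (1 / (n : ℝ)) ^ u.length := by
  induction u with
  | nil => simp [leftEnd]
  | cons i u ih =>
    simp only [List.cons_append, leftEnd, ih, List.length_cons, pow_succ]
    ring

theorem leftEnd_mem (w : List (Fin n)) :
    0 ≤ leftEnd w ∧ leftEnd w + (1 / (n : ℝ)) ^ w.length ≤ 1 := by
  induction w with
  | nil => simp [leftEnd]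
  | cons i w ih =>
    have hn : (0 : ℝ) < n := by exact_mod_cast i.pos
    have hi : (i : ℝ) + 1 ≤ n := by exact_mod_cast i.isLt
    have hi0 : (0 : ℝ) ≤ (i : ℝ) := by positivity
    refine ⟨div_nonneg (by linarith) hn.le, ?_⟩
    have : leftEnd (i :: w) + (1 / (n : ℝ)) ^ (i :: w).length
        = ((i : ℝ) + (leftEnd w + (1 / (n : ℝ)) ^ w.length)) / n := by
      simp only [leftEnd, List.length_cons, pow_succ]
      ring
    rw [this, div_le_one hn]
    linarith

theorem pow_len_pos (hn : 2 ≤ n) (w : List (Fin n)) : 0 < (1 / (n : ℝ)) ^ w.length := by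
  have : (0 : ℝ) < n := by exact_mod_cast (by omega : 0 < n)
  positivity

theorem leftEnd_inj (u v : List (Fin n)) (hl : u.length = v.length)
    (h : leftEnd u = leftEnd v) : u = v := by
  induction u generalizing v with
  | nil => exact (List.length_eq_zero_iff.1 hl.symm).symm
  | cons i u ih =>
    cases v with
    | nil => simp at hl
    | cons j v =>
      have hn2 : (0 : ℝ) < n := by exact_mod_cast i.pos
      have h1 : (i : ℝ) + leftEnd u = j + leftEnd v := by
        simpa [leftEnd, div_left_inj' hn2.ne'] using h
      have hp : ∀ w : List (Fin n), 0 ≤ leftEnd w ∧ leftEnd w < 1 := by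
        intro w
        have := leftEnd_mem w
        have h0 : 0 < (1 / (n : ℝ)) ^ w.length := by positivity
        exact ⟨this.1, by linarith⟩
      have hij : i = j := by
        have a := hp u
        have b := hp v
        have c1 : (i : ℝ) < j + 1 := by linarith
        have c2 : (j : ℝ) < i + 1 := by linarith
        have c1' : (i : ℕ) < j + 1 := by exact_mod_cast c1
        have c2' : (j : ℕ) < i + 1 := by exact_mod_cast c2
        exact Fin.ext (by omega)
      subst hij
      rw [ih v (by simpa using hl) (by linarith)]

theorem address_unique (hn : 2 ≤ n) (u v : List (Fin n))
    (h : ∀ t ∈ Set.Icc (0 : ℝ) 1,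
      ((leftEnd u + t * (1 / (n : ℝ)) ^ u.length : ℝ) : UCircle)
        = ((leftEnd v + t * (1 / (n : ℝ)) ^ v.length : ℝ) : UCircle)) : u = v := by
  have key : ∀ t ∈ Set.Ico (0 : ℝ) 1,
      leftEnd u + t * (1 / (n : ℝ)) ^ u.length = leftEnd v + t * (1 / (n : ℝ)) ^ v.length := by
    intro t ht
    have hm : ∀ w : List (Fin n),
        leftEnd w + t * (1 / (n : ℝ)) ^ w.length ∈ Set.Ico (0 : ℝ) (0 + 1) := by
      intro w
      have h1 := leftEnd_mem w
      have h2 := pow_len_pos hn w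
      have h3 : t * (1 / (n : ℝ)) ^ w.length < 1 * (1 / (n : ℝ)) ^ w.length :=
        mul_lt_mul_of_pos_right ht.2 h2
      exact ⟨by have := mul_nonneg ht.1 h2.le; linarith [h1.1], by linarith [h1.2]⟩
    exact (AddCircle.coe_eq_coe_iff_of_mem_Ico (hm u) (hm v)).1 (h t ⟨ht.1, ht.2.le⟩)
  have h0 : leftEnd u = leftEnd v := by simpa using key 0 ⟨le_rfl, one_pos⟩
  have h1 := key (1 / 2) ⟨by norm_num, by norm_num⟩
  have h2 : (1 / (n : ℝ)) ^ u.length = (1 / (n : ℝ)) ^ v.length := by linarith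
  have hn' : (1 : ℝ) < n := by exact_mod_cast (by omega : 1 < n)
  have h3 : u.length = v.length := by
    have h4 : (n : ℝ) ^ u.length = (n : ℝ) ^ v.length := by
      simpa [one_div, inv_pow] using h2
    exact pow_right_injective₀ (by linarith) hn'.ne' h4
  exact leftEnd_inj u v h3 h0

theorem MapsAffinely.append {f : UCircle ≃ₜ UCircle} {u v : List (Fin n)}
    (h : MapsAffinely f u v) (x : List (Fin n)) : MapsAffinely f (u ++ x) (v ++ x) := by
  intro t ht
  have hx := leftEnd_mem x
  have hp : 0 ≤ (1 / (n : ℝ)) ^ x.length := by positivity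
  have h1 : t * (1 / (n : ℝ)) ^ x.length ≤ 1 * (1 / (n : ℝ)) ^ x.length :=
    mul_le_mul_of_nonneg_right ht.2 hp
  have h2 := mul_nonneg ht.1 hp
  have := h (leftEnd x + t * (1 / (n : ℝ)) ^ x.length)
    ⟨by linarith [hx.1], by linarith [hx.2]⟩
  have e : ∀ w : List (Fin n), leftEnd (w ++ x) + t * (1 / (n : ℝ)) ^ (w ++ x).length
      = leftEnd w + (leftEnd x + t * (1 / (n : ℝ)) ^ x.length) * (1 / (n : ℝ)) ^ w.length := by
    intro w
    rw [leftEnd_append, List.length_append, pow_add]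
    ring
  rw [e u, e v]
  exact this

theorem MapsAffinely.comp {f g : UCircle ≃ₜ UCircle} {u v w : List (Fin n)}
    (hf : MapsAffinely f u v) (hg : MapsAffinely g v w) : MapsAffinely (g * f) u w := by
  intro t ht
  rw [Homeomorph.mul_apply, hf t ht, hg t ht]

theorem MapsAffinely.symm {f : UCircle ≃ₜ UCircle} {u v : List (Fin n)}
    (hf : MapsAffinely f u v) : MapsAffinely f⁻¹ v u := by
  intro t ht
  rw [← hf t ht]
  exact f.symm_apply_apply _

theorem MapsAffinely.source_unique (hn : 2 ≤ n) {f : UCircle ≃ₜ UCircle} {u u' v : List (Fin n)}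
    (h : MapsAffinely f u v) (h' : MapsAffinely f u' v) : u = u' :=
  address_unique hn u u' fun t ht => f.injective ((h t ht).trans (h' t ht).symm)

end Helpers

/-- `f` takes the `n`-adic subdivision of the circle given by the leaves of `T` to the one given by
the leaves of `S`, mapping the subintervals onto one another by orientation-preserving affine
maps. -/
def TakesSubdivision {n : ℕ} (f : UCircle ≃ₜ UCircle) (T S : NTree n) : Prop :=
  (∀ u ∈ T.leaves, ∃ v ∈ S.leaves, MapsAffinely f u v) ∧
    ∀ v ∈ S.leaves, ∃ u ∈ T.leaves, MapsAffinely f u v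

theorem TakesSubdivision.symm {n : ℕ} {f : UCircle ≃ₜ UCircle} {T S : NTree n}
    (h : TakesSubdivision f T S) : TakesSubdivision f⁻¹ S T :=
  ⟨fun v hv => (h.2 v hv).imp fun _ hu => ⟨hu.1, hu.2.symm⟩,
    fun u hu => (h.1 u hu).imp fun _ hv => ⟨hv.1, hv.2.symm⟩⟩

/-- A subdivision that is taken to `S` can be expanded along any expansion of `S`. -/
theorem TakesSubdivision.expand {n : ℕ} (hn : 2 ≤ n) {f : UCircle ≃ₜ UCircle} {T S : NTree n}
    (h : TakesSubdivision f T S) (φ : List (Fin n) → NTree n) :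
    ∃ T' : NTree n, TakesSubdivision f T' (S.graft φ) := by
  classical
  choose! σ hσ using h.1
  refine ⟨T.graft fun u => φ (σ u), ?_, ?_⟩
  · intro w hw
    obtain ⟨u, hu, x, hx, rfl⟩ := NTree.mem_leaves_graft.1 hw
    exact ⟨σ u ++ x, NTree.mem_leaves_graft.2 ⟨σ u, (hσ u hu).1, x, hx, rfl⟩,
      (hσ u hu).2.append x⟩
  · intro w hw
    obtain ⟨v, hv, x, hx, rfl⟩ := NTree.mem_leaves_graft.1 hw
    obtain ⟨u, hu, huv⟩ := h.2 v hv
    have e : σ u = v := huv.symm.source_unique hn (hσ u hu).2.symm |>.symm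
    exact ⟨u ++ x, NTree.mem_leaves_graft.2 ⟨u, hu, x, by rwa [e], rfl⟩, huv.append x⟩

/-- The generalised Thompson group `T_n`: the homeomorphisms of the circle that take some `n`-adic
subdivision of the circle to some `n`-adic subdivision, by orientation-preserving affine maps on
the subintervals.  The group operation is composition. -/
def ThompsonT (n : ℕ) (hn : 2 ≤ n) : Subgroup (UCircle ≃ₜ UCircle) where
  carrier := {f | ∃ T S : NTree n, TakesSubdivision f T S}
  one_mem' := ⟨.leaf, .leaf, by
    have h : MapsAffinely (n := n) 1 [] [] := fun _ _ => rfl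
    constructor <;> simp [NTree.leaves, h]⟩
  inv_mem' := by
    rintro f ⟨T, S, h⟩
    exact ⟨S, T, h.symm⟩
  mul_mem' := by
    rintro g f ⟨U, V, hg⟩ ⟨T, S, hf⟩
    obtain ⟨T', hT⟩ := hf.expand hn U.sub
    obtain ⟨V', hV⟩ := hg.symm.expand hn S.sub
    have hV' := hV.symm
    rw [inv_inv] at hV'
    rw [NTree.graft_sub_comm] at hT
    refine ⟨T', V', ?_, ?_⟩
    · intro u hu
      obtain ⟨v, hv, huv⟩ := hT.1 u hu
      obtain ⟨w, hw, hvw⟩ := hV'.1 v hv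
      exact ⟨w, hw, huv.comp hvw⟩
    · intro w hw
      obtain ⟨v, hv, hvw⟩ := hV'.2 w hw
      obtain ⟨u, hu, huv⟩ := hT.2 v hv
      exact ⟨u, hu, huv.comp hvw⟩

/-- A cyclically labelled pair of `n`-ary trees with the same number of leaves.  The leaves of the
source tree are labelled `0, 1, 2, …` from left to right; those of the target tree are labelled
`0, 1, 2, …` cyclically from left to right, starting with the leaf in position `shift`. -/
structure TreePair (n : ℕ) where
  source : NTree n
  target : NTree n
  shift : ℕ
  length_eq : source.leaves.length = target.leaves.length
  shift_lt : shift < target.leaves.length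

namespace TreePair

variable {n : ℕ}

/-- The pairs (leaf of the source tree, leaf of the target tree) with equal labels. -/
def matching (P : TreePair n) : List (List (Fin n) × List (Fin n)) :=
  P.source.leaves.zip (P.target.leaves.rotate P.shift)

/-- The tree pair represents the homeomorphism `f`: every leaf interval of the source tree is
mapped affinely onto the leaf interval of the target tree with the same label. -/
def Represents (P : TreePair n) (f : UCircle ≃ₜ UCircle) : Prop :=
  ∀ p ∈ P.matching, MapsAffinely f p.1 p.2

/-- No simple contraction applies: there is no caret in the source tree and caret in the target
tree whose `n` edges all end in leaves and carry the same labels from left to right. -/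
def IsReduced (P : TreePair n) : Prop :=
  ¬ ∃ u v : List (Fin n), ∀ j : Fin n, (u ++ [j], v ++ [j]) ∈ P.matching

/-- The number of carets of (either tree of) a tree pair. -/
def carets (P : TreePair n) : ℕ := P.source.carets

/-- The tree pair of the generator `x_i`, `0 ≤ i ≤ n - 1`.  For `i < n - 1` the source tree is a
root caret with a caret attached at its leaf `i`, and the target tree is the all-right tree with two
carets.  For `i = n - 1` these two trees, for `i = 0`, hang from the last leaf of a root caret. -/
def x (hn : 2 ≤ n) (i : Fin n) : TreePair n where
  source := if i.val < n - 1 then .hang i (.caret n) else .hang (n - 1) (.hang 0 (.caret n))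
  target := if i.val < n - 1 then .hang (n - 1) (.caret n)
    else .hang (n - 1) (.hang (n - 1) (.caret n))
  shift := 0
  length_eq := by
    have h0 : 0 < n := by omega
    have h1 : n - 1 < n := by omega
    split_ifs <;> simp [NTree.length_leaves (show 1 ≤ n by omega), NTree.carets_hang, h0, h1]
  shift_lt := by
    rw [NTree.length_leaves (show 1 ≤ n by omega)]
    omega

/-- The tree pair of the generator `c_0`: both trees are a single caret, and the labelling of the
target tree is shifted by one to the left against that of the source tree. -/
def c₀ (hn : 2 ≤ n) : TreePair n where
  source := .caret n
  target := .caret n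
  shift := n - 1
  length_eq := rfl
  shift_lt := by
    rw [NTree.length_leaves (show 1 ≤ n by omega), NTree.carets_caret]
    omega

end TreePair

/-- The set `Σ = {x_0, …, x_{n-1}, c_0} ⊆ T_n` of the elements that are represented by the tree
pairs above. -/
def generatorsT (n : ℕ) (hn : 2 ≤ n) : Set (ThompsonT n hn) :=
  {g | (∃ i : Fin n, (TreePair.x hn i).Represents g) ∨ (TreePair.c₀ hn).Represents g}

/-- The word length of `g` with respect to `S`: the least length of a word in the elements of `S`
and their inverses with product `g`. -/
noncomputable def wordLength {G : Type*} [Group G] (S : Set G) (g : G) : ℕ :=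
  sInf {k | ∃ l : List G, (∀ s ∈ l, s ∈ S ∨ s⁻¹ ∈ S) ∧ l.prod = g ∧ l.length = k}

/-!
The argument works with the relation `TakesSubdivision f T S`, in which the leaves of `T` are
matched with those of `S` only as sets. The cyclic order comes for free: the successor of a leaf
interval is the leaf interval whose left end is the right end of the given one, and homeomorphisms
respect this (`TakesSubdivision.cyclic`). Hence every such relation comes from a tree pair, and a
homeomorphism that takes a subdivision to itself and fixes `0` is the identity
(`TakesSubdivision.eq_one`). By this last fact an element of `T_n` is known as soon as it is known
which trees it relates and where it sends `0`.

Upper bound. Write a tree as a forest hanging off the right spine. In the numbering `pos` of the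
positions along the spine, `x_r` expands the tree at position `r`, and its conjugate by the `q`-th
power of `x_0` expands the tree at position `r + (n - 1) q`. Expanding all carets from left to right
takes a tree with `N` carets to the right comb with `N` carets, and as the conjugating powers of
`x_0` telescope, this costs at most `3 N` letters (`exists_straightens`,
`exists_takesSubdivision_comb`). If `ω` takes `T` to `S`, straighten `S`, so that `0` is sent to a
left end point on the comb. A power of `x_0⁻¹` followed by a power of `c_0` moves this point back to
`0`, with at most `N + (n - 1)` letters and without changing the number of carets
(`exists_move_to_zero`). Straightening the resulting tree, and `T`, gives an element that fixes `0`
and takes the comb to itself, that is, the identity. So `ω` has length at most `10 N + (n - 1)`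
(`reach_of_takesSubdivision`), and this also shows that `Σ` generates.

Lower bound. The number of carets is subadditive under composition
(`exists_takesSubdivision_mul`), each generator has a tree pair with at most three carets, and a
reduced tree pair has the least number of carets among all pairs of trees related by the same
homeomorphism (`carets_le_of_isReduced`).

The generators themselves are built as homeomorphisms of the circle from increasing piecewise linear
bijections of the line (`xHomeo`, `cHomeo`).
-/

namespace ThompsonMetric

variable {n : ℕ}

/-! ### The order of the leaves of a tree -/

/-- The right end point of the `n`-adic interval with address `w`. -/
noncomputable def rightEnd (w : List (Fin n)) : ℝ := leftEnd w + (1 / (n : ℝ)) ^ w.length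

/-- The intervals of the addresses in the list tile `[a, b]` from left to right. -/
def Tiles : ℝ → ℝ → List (List (Fin n)) → Prop
  | a, b, [] => a = b
  | a, b, w :: l => leftEnd w = a ∧ Tiles (rightEnd w) b l

theorem Tiles.append {a b c : ℝ} {l l' : List (List (Fin n))} (h : Tiles a b l)
    (h' : Tiles b c l') : Tiles a c (l ++ l') := by
  induction l generalizing a with
  | nil => obtain rfl : a = b := h; exact h'
  | cons w l ih => exact ⟨h.1, ih h.2⟩

theorem Tiles.map_cons {a b : ℝ} {l : List (List (Fin n))} (h : Tiles a b l) (i : Fin n) :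
    Tiles ((i + a) / n) ((i + b) / n) (l.map (i :: ·)) := by
  induction l generalizing a with
  | nil => obtain rfl : a = b := h; rfl
  | cons w l ih =>
    refine ⟨by rw [← h.1]; rfl, ?_⟩
    have : rightEnd (i :: w) = (i + rightEnd w) / n := by
      simp only [rightEnd, leftEnd, List.length_cons, pow_succ]; ring
    rw [this]
    exact ih h.2

theorem rightEnd_le_one (w : List (Fin n)) : rightEnd w ≤ 1 := (leftEnd_mem w).2

theorem leftEnd_nonneg (w : List (Fin n)) : 0 ≤ leftEnd w := (leftEnd_mem w).1

theorem leftEnd_lt_rightEnd (hn : 2 ≤ n) (w : List (Fin n)) : leftEnd w < rightEnd w := by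
  have := pow_len_pos hn w
  unfold rightEnd
  linarith

theorem leftEnd_lt_one (hn : 2 ≤ n) (w : List (Fin n)) : leftEnd w < 1 :=
  (leftEnd_lt_rightEnd hn w).trans_le (rightEnd_le_one w)

theorem tiles_leaves (hn : 2 ≤ n) (T : NTree n) : Tiles 0 1 T.leaves := by
  have hn0 : (n : ℝ) ≠ 0 := by exact_mod_cast (by omega : n ≠ 0)
  induction T with
  | leaf => simp [NTree.leaves, Tiles, leftEnd, rightEnd]
  | node c ih =>
    have key : ∀ k ≤ n, Tiles 0 ((k : ℝ) / n)
        (((List.finRange n).take k).flatMap fun i => (c i).leaves.map (fun w => i :: w)) := by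
      intro k
      induction k with
      | zero => intro _; simp [Tiles]
      | succ k ihk =>
        intro hk
        rw [List.take_add_one, List.getElem?_eq_getElem (by simpa using hk), List.flatMap_append]
        refine (ihk (by omega)).append ?_
        have := (ih ⟨k, hk⟩).map_cons ⟨k, hk⟩
        simpa using this
    have := key n le_rfl
    rw [List.take_of_length_le (by simp), div_self hn0] at this
    exact this

theorem Tiles.le_of_mem (hn : 2 ≤ n) {a b : ℝ} {l : List (List (Fin n))} (h : Tiles a b l)
    {w : List (Fin n)} (hw : w ∈ l) : a ≤ leftEnd w := by
  induction l generalizing a with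
  | nil => simp at hw
  | cons v l ih =>
    rcases List.mem_cons.1 hw with rfl | hw
    · exact h.1.ge
    · have := ih h.2 hw
      have := leftEnd_lt_rightEnd hn v
      linarith [h.1]

theorem Tiles.pairwise (hn : 2 ≤ n) {a b : ℝ} {l : List (List (Fin n))} (h : Tiles a b l) :
    l.Pairwise fun u v => leftEnd u < leftEnd v := by
  induction l generalizing a with
  | nil => exact List.Pairwise.nil
  | cons v l ih =>
    exact List.pairwise_cons.2
      ⟨fun w hw => (leftEnd_lt_rightEnd hn v).trans_le (h.2.le_of_mem hn hw), ih h.2⟩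

theorem Tiles.exists_mem {a b x : ℝ} {l : List (List (Fin n))} (h : Tiles a b l)
    (hx : x ∈ Set.Ico a b) : ∃ w ∈ l, x ∈ Set.Ico (leftEnd w) (rightEnd w) := by
  induction l generalizing a with
  | nil => obtain rfl : a = b := h; exact absurd hx.2 (not_lt.2 hx.1)
  | cons v l ih =>
    rcases lt_or_ge x (rightEnd v) with hv | hv
    · exact ⟨v, by simp, by rw [h.1]; exact hx.1, hv⟩
    · obtain ⟨w, hw, h'⟩ := ih h.2 ⟨hv, hx.2⟩
      exact ⟨w, by simp [hw], h'⟩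

theorem Tiles.rightEnd_getElem {a b : ℝ} {l : List (List (Fin n))} (h : Tiles a b l)
    (i : ℕ) (hi : i < l.length) :
    (∀ hi' : i + 1 < l.length, rightEnd l[i] = leftEnd l[i + 1]) ∧
      (i + 1 = l.length → rightEnd l[i] = b) := by
  induction l generalizing a i with
  | nil => simp at hi
  | cons v l ih =>
    cases i with
    | zero =>
      cases l with
      | nil => exact ⟨fun h' => by simp at h', fun _ => h.2⟩
      | cons w l => simpa using h.2.1.symm
    | succ i => simpa using ih h.2 i (by simpa using hi)

theorem leaves_length_pos (hn : 2 ≤ n) (T : NTree n) : 0 < T.leaves.length := by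
  rw [NTree.length_leaves (by omega)]; omega

theorem Tiles.leftEnd_getElem_zero {a b : ℝ} {l : List (List (Fin n))} (h : Tiles a b l)
    (hl : 0 < l.length) : leftEnd l[0] = a := by
  cases l with
  | nil => simp at hl
  | cons w l => exact h.1

theorem leftEnd_leaves_zero (hn : 2 ≤ n) (T : NTree n) :
    leftEnd (T.leaves[0]'(leaves_length_pos hn T)) = 0 :=
  (tiles_leaves hn T).leftEnd_getElem_zero _

theorem nodup_leaves (hn : 2 ≤ n) (T : NTree n) : T.leaves.Nodup :=
  ((tiles_leaves hn T).pairwise hn).imp fun h e => h.ne (by rw [e])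

theorem leftEnd_injOn_leaves (hn : 2 ≤ n) (T : NTree n) {u v : List (Fin n)} (hu : u ∈ T.leaves)
    (hv : v ∈ T.leaves) (h : leftEnd u = leftEnd v) : u = v := by
  obtain ⟨i, hi, rfl⟩ := List.getElem_of_mem hu
  obtain ⟨j, hj, rfl⟩ := List.getElem_of_mem hv
  have hp := List.pairwise_iff_getElem.1 ((tiles_leaves hn T).pairwise hn)
  rcases lt_trichotomy i j with hij | rfl | hij
  · exact absurd h (hp i j hi hj hij).ne
  · rfl
  · exact absurd h (hp j i hj hi hij).ne'

theorem coe_leftEnd_inj (hn : 2 ≤ n) {u v : List (Fin n)}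
    (h : (leftEnd u : UCircle) = (leftEnd v : UCircle)) : leftEnd u = leftEnd v := by
  have hm : ∀ w : List (Fin n), leftEnd w ∈ Set.Ico (0 : ℝ) (0 + 1) := fun w =>
    ⟨leftEnd_nonneg w, by simpa using leftEnd_lt_one hn w⟩
  exact (AddCircle.coe_eq_coe_iff_of_mem_Ico (hm u) (hm v)).1 h

theorem _root_.MapsAffinely.leftEnd {f : UCircle ≃ₜ UCircle} {u v : List (Fin n)}
    (h : MapsAffinely f u v) : f (leftEnd u : UCircle) = (leftEnd v : UCircle) := by
  simpa using h 0 ⟨le_rfl, zero_le_one⟩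

theorem _root_.MapsAffinely.rightEnd {f : UCircle ≃ₜ UCircle} {u v : List (Fin n)}
    (h : MapsAffinely f u v) : f (rightEnd u : UCircle) = (rightEnd v : UCircle) := by
  simpa [ThompsonMetric.rightEnd] using h 1 ⟨zero_le_one, le_rfl⟩

theorem _root_.MapsAffinely.target_unique (hn : 2 ≤ n) {f : UCircle ≃ₜ UCircle}
    {u v v' : List (Fin n)} (h : MapsAffinely f u v) (h' : MapsAffinely f u v') : v = v' :=
  address_unique hn v v' fun t ht => (h t ht).symm.trans (h' t ht)

theorem mapsAffinely_one (u : List (Fin n)) : MapsAffinely 1 u u := fun _ _ => rfl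

/-! ### Subdivisions and the homeomorphisms between them -/

theorem exists_leaf_of_mem_Icc (hn : 2 ≤ n) (T : NTree n) {x : ℝ} (hx : x ∈ Set.Icc (0 : ℝ) 1) :
    ∃ u ∈ T.leaves, ∃ t ∈ Set.Icc (0 : ℝ) 1, x = leftEnd u + t * (1 / (n : ℝ)) ^ u.length := by
  rcases hx.2.lt_or_eq with hx1 | rfl
  · obtain ⟨u, hu, hxu⟩ := (tiles_leaves hn T).exists_mem ⟨hx.1, hx1⟩
    have hp := pow_len_pos hn u
    refine ⟨u, hu, (x - leftEnd u) / (1 / (n : ℝ)) ^ u.length, ⟨?_, ?_⟩, ?_⟩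
    · exact div_nonneg (by linarith [hxu.1]) hp.le
    · rw [div_le_one hp]
      have := hxu.2
      unfold rightEnd at this
      linarith
    · rw [div_mul_cancel₀ _ hp.ne']
      ring
  · have hl := leaves_length_pos hn T
    have h := ((tiles_leaves hn T).rightEnd_getElem (T.leaves.length - 1) (by omega)).2 (by omega)
    exact ⟨_, List.getElem_mem _, 1, ⟨zero_le_one, le_rfl⟩, by rw [one_mul]; exact h.symm⟩

/-- Every point of the circle lies in a leaf interval of `T`. -/
theorem exists_leaf (hn : 2 ≤ n) (T : NTree n) (p : UCircle) :
    ∃ u ∈ T.leaves, ∃ t ∈ Set.Icc (0 : ℝ) 1,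
      p = ((leftEnd u + t * (1 / (n : ℝ)) ^ u.length : ℝ) : UCircle) := by
  obtain ⟨x, hx, rfl⟩ : ∃ x ∈ Set.Ico (0 : ℝ) 1, (x : UCircle) = p :=
    ⟨(AddCircle.equivIco 1 0 p : ℝ), by simpa using (AddCircle.equivIco 1 0 p).2,
      AddCircle.coe_equivIco⟩
  obtain ⟨u, hu, t, ht, e⟩ := exists_leaf_of_mem_Icc hn T (Set.Ico_subset_Icc_self hx)
  exact ⟨u, hu, t, ht, by rw [← e]⟩

theorem mapsAffinely_of_forall_leaf (hn : 2 ≤ n) (T : NTree n) {f : UCircle ≃ₜ UCircle}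
    {u v : List (Fin n)} (h : ∀ x ∈ T.leaves, MapsAffinely f (u ++ x) (v ++ x)) :
    MapsAffinely f u v := by
  intro t ht
  obtain ⟨x, hx, s, hs, rfl⟩ := exists_leaf_of_mem_Icc hn T ht
  have e : ∀ w : List (Fin n), leftEnd w
      + (leftEnd x + s * (1 / (n : ℝ)) ^ x.length) * (1 / (n : ℝ)) ^ w.length
      = leftEnd (w ++ x) + s * (1 / (n : ℝ)) ^ (w ++ x).length := by
    intro w
    rw [leftEnd_append, List.length_append, pow_add]
    ring
  rw [e, e]
  exact h x hx s hs

theorem eq_one_of_forall_leaf (hn : 2 ≤ n) (T : NTree n) {f : UCircle ≃ₜ UCircle}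
    (h : ∀ u ∈ T.leaves, MapsAffinely f u u) : f = 1 := by
  ext p
  obtain ⟨u, hu, t, ht, rfl⟩ := exists_leaf hn T p
  exact h u hu t ht

theorem _root_.TakesSubdivision.comp {f g : UCircle ≃ₜ UCircle} {T S U : NTree n}
    (hg : TakesSubdivision g S U) (hf : TakesSubdivision f T S) : TakesSubdivision (g * f) T U := by
  constructor
  · intro u hu
    obtain ⟨v, hv, huv⟩ := hf.1 u hu
    obtain ⟨w, hw, hvw⟩ := hg.1 v hv
    exact ⟨w, hw, huv.comp hvw⟩
  · intro w hw
    obtain ⟨v, hv, hvw⟩ := hg.2 w hw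
    obtain ⟨u, hu, huv⟩ := hf.2 v hv
    exact ⟨u, hu, huv.comp hvw⟩

theorem takesSubdivision_one (T : NTree n) : TakesSubdivision 1 T T :=
  ⟨fun u hu => ⟨u, hu, mapsAffinely_one u⟩, fun u hu => ⟨u, hu, mapsAffinely_one u⟩⟩

theorem length_leaves_le (hn : 2 ≤ n) {f : UCircle ≃ₜ UCircle} {T S : NTree n}
    (h : ∀ u ∈ T.leaves, ∃ v ∈ S.leaves, MapsAffinely f u v) :
    T.leaves.length ≤ S.leaves.length := by
  classical
  choose! σ hσ using h
  rw [← List.toFinset_card_of_nodup (nodup_leaves hn T),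
    ← List.toFinset_card_of_nodup (nodup_leaves hn S)]
  refine Finset.card_le_card_of_injOn σ (fun u hu => ?_) fun u hu v hv e => ?_
  · simpa using (hσ u (by simpa using hu)).1
  · have h1 := (hσ u (by simpa using hu)).2
    rw [e] at h1
    exact h1.source_unique hn (hσ v (by simpa using hv)).2

theorem _root_.TakesSubdivision.length_eq (hn : 2 ≤ n) {f : UCircle ≃ₜ UCircle} {T S : NTree n}
    (h : TakesSubdivision f T S) : T.leaves.length = S.leaves.length :=
  (length_leaves_le hn h.1).antisymm (length_leaves_le hn h.symm.1)

theorem carets_eq_of_length_eq (hn : 2 ≤ n) {T S : NTree n}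
    (h : T.leaves.length = S.leaves.length) : T.carets = S.carets := by
  rw [NTree.length_leaves (by omega), NTree.length_leaves (by omega)] at h
  exact Nat.eq_of_mul_eq_mul_left (by omega : 0 < n - 1) (Nat.add_right_cancel h)

/-- If the trees have equally many carets, then it is enough to know that leaves go to leaves. -/
theorem takesSubdivision_of_forall (hn : 2 ≤ n) {f : UCircle ≃ₜ UCircle} {T S : NTree n}
    (hc : T.carets = S.carets) (h : ∀ u ∈ T.leaves, ∃ v ∈ S.leaves, MapsAffinely f u v) :
    TakesSubdivision f T S := by
  classical
  refine ⟨h, ?_⟩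
  have h' := h
  choose! σ hσ using h'
  intro v hv
  have hl : S.leaves.toFinset.card ≤ T.leaves.toFinset.card := by
    rw [List.toFinset_card_of_nodup (nodup_leaves hn T),
      List.toFinset_card_of_nodup (nodup_leaves hn S), NTree.length_leaves (by omega),
      NTree.length_leaves (by omega), hc]
  obtain ⟨u, hu, e⟩ := Finset.surj_on_of_inj_on_of_card_le
    (s := T.leaves.toFinset) (t := S.leaves.toFinset) (fun u _ => σ u)
    (fun u hu => by simpa using (hσ u (by simpa using hu)).1)
    (fun u v hu hv e => by
      have h1 := (hσ u (by simpa using hu)).2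
      rw [e] at h1
      exact h1.source_unique hn (hσ v (by simpa using hv)).2) hl v (by simpa using hv)
  exact ⟨u, by simpa using hu, e ▸ (hσ u (by simpa using hu)).2⟩

/-- The right end of a leaf interval is the left end of the next one.  The last leaf is followed by
the first, because `0` and `1` are the same point of the circle. -/
theorem coe_rightEnd_leaves (hn : 2 ≤ n) (T : NTree n) (i : ℕ) (hi : i < T.leaves.length) :
    (rightEnd T.leaves[i] : UCircle)
      = (leftEnd (T.leaves[(i + 1) % T.leaves.length]'(Nat.mod_lt _ (leaves_length_pos hn T))) :
          UCircle) := by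
  have h := (tiles_leaves hn T).rightEnd_getElem i hi
  rcases Nat.lt_or_ge (i + 1) T.leaves.length with h1 | h1
  · simp only [Nat.mod_eq_of_lt h1]
    rw [h.1 h1]
  · have h2 : i + 1 = T.leaves.length := by omega
    rw [h.2 h2]
    simp only [h2, Nat.mod_self]
    rw [leftEnd_leaves_zero hn T]
    simp [AddCircle.coe_period]

/-- A homeomorphism between subdivisions preserves the cyclic order of the leaves: the successor of
a leaf interval is the one whose left end is the right end of the given one. -/
theorem _root_.TakesSubdivision.cyclic (hn : 2 ≤ n) {f : UCircle ≃ₜ UCircle} {T S : NTree n}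
    (h : TakesSubdivision f T S) (k : ℕ) (hk : k < S.leaves.length)
    (h0 : f 0 = (leftEnd S.leaves[k] : UCircle)) (i : ℕ) (hi : i < T.leaves.length) :
    MapsAffinely f T.leaves[i]
      (S.leaves[(i + k) % S.leaves.length]'(Nat.mod_lt _ (leaves_length_pos hn S))) := by
  induction i with
  | zero =>
    obtain ⟨v, hv, huv⟩ := h.1 _ (List.getElem_mem hi)
    have h1 := huv.leftEnd
    rw [leftEnd_leaves_zero hn T] at h1
    have h2 := coe_leftEnd_inj hn (h1.symm.trans (by simpa using h0))
    have h3 := leftEnd_injOn_leaves hn S hv (List.getElem_mem hk) h2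
    simp only [zero_add, Nat.mod_eq_of_lt hk]
    rwa [← h3]
  | succ i ih =>
    have ih := ih (by omega)
    obtain ⟨v, hv, huv⟩ := h.1 _ (List.getElem_mem hi)
    have h1 := huv.leftEnd
    have h2 := coe_rightEnd_leaves hn T i (by omega)
    simp only [Nat.mod_eq_of_lt hi] at h2
    rw [← h2, ih.rightEnd, coe_rightEnd_leaves hn S] at h1
    have h3 := leftEnd_injOn_leaves hn S (List.getElem_mem _) hv (coe_leftEnd_inj hn h1)
    rw [← h3] at huv
    have e : ((i + k) % S.leaves.length + 1) % S.leaves.length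
        = (i + 1 + k) % S.leaves.length := by
      rw [Nat.mod_add_mod]; congr 1; omega
    simpa only [e] using huv

theorem _root_.TakesSubdivision.exists_leaf_zero (hn : 2 ≤ n) {f : UCircle ≃ₜ UCircle}
    {T S : NTree n} (h : TakesSubdivision f T S) :
    ∃ v ∈ S.leaves, f 0 = (leftEnd v : UCircle) := by
  obtain ⟨v, hv, huv⟩ := h.1 _ (List.getElem_mem (leaves_length_pos hn T))
  refine ⟨v, hv, ?_⟩
  rw [← huv.leftEnd, leftEnd_leaves_zero hn T]
  rfl

/-- The point `0` pins the shift, hence the image of every leaf. -/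
theorem _root_.TakesSubdivision.eq_one (hn : 2 ≤ n) {f : UCircle ≃ₜ UCircle} {T : NTree n}
    (h : TakesSubdivision f T T) (h0 : f 0 = 0) : f = 1 := by
  have hl := leaves_length_pos hn T
  refine eq_one_of_forall_leaf hn T fun u hu => ?_
  obtain ⟨i, hi, rfl⟩ := List.getElem_of_mem hu
  have := h.cyclic hn 0 hl (by rw [h0, leftEnd_leaves_zero hn T]; rfl) i hi
  simpa only [add_zero, Nat.mod_eq_of_lt hi] using this

theorem represents_of_takesSubdivision (hn : 2 ≤ n) {P : TreePair n} {f : UCircle ≃ₜ UCircle}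
    (h : TakesSubdivision f P.source P.target)
    (h0 : f 0 = (leftEnd (P.target.leaves[P.shift]'P.shift_lt) : UCircle)) : P.Represents f := by
  intro p hp
  obtain ⟨i, hi, rfl⟩ := List.getElem_of_mem hp
  have hi' : i < P.source.leaves.length := by
    simp only [TreePair.matching, List.length_zip] at hi; omega
  have := h.cyclic hn P.shift P.shift_lt h0 i hi'
  simpa [TreePair.matching, List.getElem_rotate] using this

/-- Two trees that are related by a homeomorphism underlie a tree pair that represents it; the
shift is read off from the image of `0`. -/
theorem exists_represents (hn : 2 ≤ n) {T S : NTree n} {f : UCircle ≃ₜ UCircle}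
    (h : TakesSubdivision f T S) : ∃ P : TreePair n, P.source = T ∧ P.target = S ∧
      P.Represents f := by
  obtain ⟨v, hv, h0⟩ := h.exists_leaf_zero hn
  obtain ⟨k, hk, rfl⟩ := List.getElem_of_mem hv
  exact ⟨⟨T, S, k, h.length_eq hn, hk⟩, rfl, rfl, represents_of_takesSubdivision hn h h0⟩

theorem exists_matching_left (P : TreePair n) {u : List (Fin n)} (hu : u ∈ P.source.leaves) :
    ∃ v ∈ P.target.leaves, (u, v) ∈ P.matching := by
  obtain ⟨i, hi, rfl⟩ := List.getElem_of_mem hu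
  have h1 : i < (P.target.leaves.rotate P.shift).length := by
    rw [List.length_rotate, ← P.length_eq]; exact hi
  refine ⟨(P.target.leaves.rotate P.shift)[i], List.mem_rotate.1 (List.getElem_mem h1), ?_⟩
  rw [TreePair.matching, List.mem_iff_getElem]
  exact ⟨i, by simp only [List.length_zip]; omega, by simp⟩

theorem exists_matching_right (P : TreePair n) {v : List (Fin n)} (hv : v ∈ P.target.leaves) :
    ∃ u ∈ P.source.leaves, (u, v) ∈ P.matching := by
  obtain ⟨i, hi, rfl⟩ :=
    List.getElem_of_mem (List.mem_rotate.2 hv : v ∈ P.target.leaves.rotate P.shift)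
  have h1 : i < P.source.leaves.length := by
    rw [List.length_rotate, ← P.length_eq] at hi; exact hi
  refine ⟨P.source.leaves[i], List.getElem_mem h1, ?_⟩
  rw [TreePair.matching, List.mem_iff_getElem]
  exact ⟨i, by simp only [List.length_zip]; omega, by simp⟩

theorem _root_.TreePair.Represents.takesSubdivision {P : TreePair n} {f : UCircle ≃ₜ UCircle}
    (h : P.Represents f) : TakesSubdivision f P.source P.target := by
  constructor
  · intro u hu
    obtain ⟨v, hv, huv⟩ := exists_matching_left P hu
    exact ⟨v, hv, h _ huv⟩
  · intro v hv
    obtain ⟨u, hu, huv⟩ := exists_matching_right P hv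
    exact ⟨u, hu, h _ huv⟩

/-! ### Homeomorphisms of the circle from increasing bijections of the line -/

/-- The homeomorphism of the circle induced by an increasing bijection of `ℝ` that fixes `0`
and `1`. -/
noncomputable def circleHomeo (F : ℝ ≃o ℝ) (h0 : F 0 = 0) (h1 : F 1 = 1) : UCircle ≃ₜ UCircle :=
  have key : ∀ G : ℝ ≃o ℝ, G 0 = 0 → G 1 = 1 →
      Continuous (AddCircle.liftIco (1 : ℝ) 0 fun x => (G x : UCircle)) := by
    intro G g0 g1
    refine AddCircle.liftIco_continuous ?_ ?_
    · simp [g0, g1, AddCircle.coe_period]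
    · exact ((AddCircle.continuous_mk' (1 : ℝ)).comp G.continuous).continuousOn
  have inv : ∀ G : ℝ ≃o ℝ, G 0 = 0 → G 1 = 1 → Function.LeftInverse
      (AddCircle.liftIco (1 : ℝ) 0 fun x => (G.symm x : UCircle))
      (AddCircle.liftIco (1 : ℝ) 0 fun x => (G x : UCircle)) := by
    intro G g0 g1 p
    obtain ⟨x, hx, rfl⟩ : ∃ x ∈ Set.Ico (0 : ℝ) (0 + 1), (x : UCircle) = p :=
      ⟨(AddCircle.equivIco 1 0 p : ℝ), (AddCircle.equivIco 1 0 p).2, AddCircle.coe_equivIco⟩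
    have hG : G x ∈ Set.Ico (0 : ℝ) (0 + 1) := by
      rw [zero_add] at hx ⊢
      exact ⟨by rw [← g0]; exact G.monotone hx.1, by
        conv_rhs => rw [← g1]
        exact G.strictMono hx.2⟩
    rw [AddCircle.liftIco_coe_apply hx, AddCircle.liftIco_coe_apply hG, G.symm_apply_apply]
  have s0 : F.symm 0 = 0 := by rw [OrderIso.symm_apply_eq, h0]
  have s1 : F.symm 1 = 1 := by rw [OrderIso.symm_apply_eq, h1]
  { toFun := AddCircle.liftIco (1 : ℝ) 0 fun x => (F x : UCircle)
    invFun := AddCircle.liftIco (1 : ℝ) 0 fun x => (F.symm x : UCircle)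
    left_inv := inv F h0 h1
    right_inv := inv F.symm s0 s1
    continuous_toFun := key F h0 h1
    continuous_invFun := key F.symm s0 s1 }

theorem circleHomeo_coe {F : ℝ ≃o ℝ} (h0 : F 0 = 0) (h1 : F 1 = 1) {x : ℝ}
    (hx : x ∈ Set.Icc (0 : ℝ) 1) : circleHomeo F h0 h1 (x : UCircle) = (F x : UCircle) := by
  rcases hx.2.lt_or_eq with hx1 | rfl
  · exact AddCircle.liftIco_coe_apply (f := fun x => (F x : UCircle))
      (show x ∈ Set.Ico (0 : ℝ) (0 + 1) from ⟨hx.1, by simpa using hx1⟩)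
  · have := AddCircle.liftIco_coe_apply (p := (1 : ℝ)) (a := 0) (f := fun x => (F x : UCircle))
      (show (0 : ℝ) ∈ Set.Ico (0 : ℝ) (0 + 1) by simp)
    rw [AddCircle.coe_period, h1, AddCircle.coe_period]
    refine Eq.trans ?_ (this.trans ?_)
    · rfl
    · simp [h0]

/-- `F` maps the `n`-adic interval of the address `u` onto that of the address `v` by the
increasing affine map. -/
def LineMapsAffinely (F : ℝ → ℝ) (u v : List (Fin n)) : Prop :=
  ∀ t ∈ Set.Icc (0 : ℝ) 1,
    F (leftEnd u + t * (1 / (n : ℝ)) ^ u.length) = leftEnd v + t * (1 / (n : ℝ)) ^ v.length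

theorem LineMapsAffinely.mapsAffinely {F : ℝ ≃o ℝ} (h0 : F 0 = 0) (h1 : F 1 = 1)
    {u v : List (Fin n)} (h : LineMapsAffinely F u v) :
    MapsAffinely (circleHomeo F h0 h1) u v := by
  intro t ht
  have hu := leftEnd_mem u
  have hp : 0 ≤ (1 / (n : ℝ)) ^ u.length := by positivity
  have ha := mul_nonneg ht.1 hp
  have hb := mul_le_of_le_one_left hp ht.2
  rw [circleHomeo_coe h0 h1 ⟨by linarith [hu.1], by linarith [hu.2]⟩, h t ht]

/-- The increasing bijection `x ↦ a * x + b`. -/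
noncomputable def affineIso (a b : ℝ) (ha : 0 < a) : ℝ ≃o ℝ where
  toFun x := a * x + b
  invFun y := (y - b) / a
  left_inv x := by field_simp; ring
  right_inv y := by field_simp; ring
  map_rel_iff' := by
    intro x y
    simp [ha]

/-- The pointwise maximum of two increasing bijections. -/
noncomputable def maxIso (f g : ℝ ≃o ℝ) : ℝ ≃o ℝ where
  toFun x := max (f x) (g x)
  invFun y := min (f.symm y) (g.symm y)
  left_inv x := by
    beta_reduce
    apply le_antisymm
    · rcases le_total (f x) (g x) with h | h
      · rw [max_eq_right h]; exact (min_le_right _ _).trans (by simp)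
      · rw [max_eq_left h]; exact (min_le_left _ _).trans (by simp)
    · refine le_min ?_ ?_
      · rw [OrderIso.le_symm_apply]; exact le_max_left _ _
      · rw [OrderIso.le_symm_apply]; exact le_max_right _ _
  right_inv y := by
    beta_reduce
    apply le_antisymm
    · refine max_le ?_ ?_
      · rw [← OrderIso.le_symm_apply]; exact min_le_left _ _
      · rw [← OrderIso.le_symm_apply]; exact min_le_right _ _
    · rcases le_total (f.symm y) (g.symm y) with h | h
      · rw [min_eq_left h]; exact le_trans (by simp) (le_max_left _ _)
      · rw [min_eq_right h]; exact le_trans (by simp) (le_max_right _ _)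
  map_rel_iff' := by
    intro x y
    refine ⟨fun h => ?_, fun h => max_le_max (f.monotone h) (g.monotone h)⟩
    by_contra hxy
    rw [not_le] at hxy
    exact absurd h (not_le.2 (max_lt_max (f.strictMono hxy) (g.strictMono hxy)))

/-- The pointwise minimum of two increasing bijections. -/
noncomputable def minIso (f g : ℝ ≃o ℝ) : ℝ ≃o ℝ := (maxIso f.symm g.symm).symm

theorem maxIso_apply (f g : ℝ ≃o ℝ) (x : ℝ) : maxIso f g x = max (f x) (g x) := rfl

theorem minIso_apply (f g : ℝ ≃o ℝ) (x : ℝ) : minIso f g x = min (f x) (g x) := rfl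

theorem affineIso_apply (a b : ℝ) (ha : 0 < a) (x : ℝ) : affineIso a b ha x = a * x + b := rfl

/-! ### The generators as homeomorphisms -/

theorem cast_pos_of_two_le (hn : 2 ≤ n) : (0 : ℝ) < n := by exact_mod_cast (by omega : 0 < n)

/-- The piecewise linear map of the line that is the identity on `(-∞, i / n]`, has slope `n` on
the next interval, then slope `1`, and slope `1 / n` on `[(i + 1) / n, ∞)`.  On `[0, 1]` it is the
generator `x_i` with `i < n - 1`.  Beyond `i / n` it is concave, hence a minimum of affine maps. -/
noncomputable def xLine (hn : 2 ≤ n) (i : ℕ) : ℝ ≃o ℝ :=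
  have h0 := cast_pos_of_two_le hn
  maxIso (affineIso 1 0 one_pos)
    (minIso (affineIso n (i / n - i) h0)
      (minIso (affineIso 1 ((n - 1 - i) * (n - 1) / n ^ 2) one_pos)
        (affineIso (1 / n) (1 - 1 / n) (by positivity))))

theorem xLine_apply (hn : 2 ≤ n) (i : ℕ) (x : ℝ) :
    xLine hn i x = max x (min (n * x + (i / n - i))
      (min (x + (n - 1 - i) * (n - 1) / n ^ 2) (1 / n * x + (1 - 1 / n)))) := by
  simp [xLine, maxIso_apply, minIso_apply, affineIso_apply]

/-- The four affine pieces of `xLine`, in the coordinate `y = n * x`. -/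
theorem xLine_pieces (hn : 2 ≤ n) {i : ℕ} (hi : i + 1 < n) (y : ℝ) :
    (y ≤ i → xLine hn i (y / n) = y / n) ∧
    (i ≤ y → y ≤ i + (n - 1 - i) / n → xLine hn i (y / n) = y + (i / n - i)) ∧
    (i + (n - 1 - i) / n ≤ y → y ≤ i + 1 →
      xLine hn i (y / n) = y / n + (n - 1 - i) * (n - 1) / n ^ 2) ∧
    (i + 1 ≤ y → y ≤ n → xLine hn i (y / n) = y / n / n + (1 - 1 / n)) := by
  have h0 := cast_pos_of_two_le hn
  have h2 : (2 : ℝ) ≤ n := by exact_mod_cast hn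
  have hi' : (i : ℝ) + 1 < n := by exact_mod_cast hi
  have hi0 : (0 : ℝ) ≤ i := by positivity
  have eA : (n : ℝ) * (y / n) = y := by field_simp
  -- The differences of neighbouring pieces, factored so that their signs can be read off.
  have dA : y + (i / n - i) - y / n = (n - 1) * (y - i) / n := by field_simp; ring
  have dAB : y + (i / n - i) - (y / n + (n - 1 - i) * (n - 1) / n ^ 2)
      = (n - 1) * (y - (i + (n - 1 - i) / n)) / n := by field_simp; ring
  have dBC : (y / n + (n - 1 - i) * (n - 1) / n ^ 2) - (1 / n * (y / n) + (1 - 1 / n))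
      = (n - 1) * (y - (i + 1)) / n ^ 2 := by field_simp; ring
  have dC : (1 / n * (y / n) + (1 - 1 / n)) - y / n = (n - 1) * (n - y) / n ^ 2 := by
    field_simp; ring
  have dB : (n - 1 - i) * (n - 1) / (n : ℝ) ^ 2 ≥ 0 :=
    div_nonneg (mul_nonneg (by linarith) (by linarith)) (by positivity)
  have hq : ((n : ℝ) - 1 - i) / n ≤ 1 := by rw [div_le_one h0]; linarith
  have hq0 : 0 ≤ ((n : ℝ) - 1 - i) / n := div_nonneg (by linarith) h0.le
  have pos : ∀ z : ℝ, 0 ≤ z → ∀ w : ℝ, 0 < w → 0 ≤ (n - 1) * z / w := fun z hz w hw =>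
    div_nonneg (mul_nonneg (by linarith) hz) hw.le
  have neg : ∀ z : ℝ, z ≤ 0 → ∀ w : ℝ, 0 < w → (n - 1) * z / w ≤ 0 := fun z hz w hw =>
    div_nonpos_of_nonpos_of_nonneg (mul_nonpos_of_nonneg_of_nonpos (by linarith) hz) hw.le
  have hn2 : (0 : ℝ) < (n : ℝ) ^ 2 := by positivity
  rw [xLine_apply, eA]
  refine ⟨fun h => ?_, fun h h' => ?_, fun h h' => ?_, fun h h' => ?_⟩
  · refine max_eq_left ((min_le_left _ _).trans ?_)
    linarith [neg (y - i) (by linarith) n h0]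
  · have h3 := pos (y - i) (by linarith) n h0
    have h4 := neg (y - (i + (n - 1 - i) / n)) (by linarith) n h0
    have h5 := neg (y - (i + 1)) (by linarith) _ hn2
    rw [min_eq_left (le_min (by linarith) (by linarith)), max_eq_right (by linarith)]
  · have h4 := pos (y - (i + (n - 1 - i) / n)) (by linarith) n h0
    have h5 := neg (y - (i + 1)) (by linarith) _ hn2
    rw [min_eq_left (a := y / n + _) (by linarith), min_eq_right (by linarith),
      max_eq_right (by linarith)]
  · have h4 := pos (y - (i + (n - 1 - i) / n)) (by linarith) n h0
    have h5 := pos (y - (i + 1)) (by linarith) _ hn2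
    have h6 := pos (n - y) (by linarith) _ hn2
    rw [min_eq_right (a := y / n + _) (by linarith), min_eq_right (by linarith),
      max_eq_right (by linarith)]
    ring

/-- The last child of a vertex. -/
def last (hn : 2 ≤ n) : Fin n := ⟨n - 1, by omega⟩

theorem cast_last (hn : 2 ≤ n) : ((last hn : ℕ) : ℝ) = n - 1 := by
  simp [last, Nat.cast_sub (show 1 ≤ n by omega)]

theorem xLine_lt (hn : 2 ≤ n) {i : ℕ} (hi : i + 1 < n) {m : Fin n} (hm : m.val < i) :
    LineMapsAffinely (xLine hn i) [m] [m] := by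
  intro t ht
  have h := (xLine_pieces hn hi (m + t)).1 (by
    have : (m : ℝ) + 1 ≤ i := by exact_mod_cast hm
    linarith [ht.2])
  have e : leftEnd [m] + t * (1 / (n : ℝ)) ^ [m].length = (m + t) / n := by
    simp [leftEnd]; ring
  rw [e, h]

theorem xLine_at_left (hn : 2 ≤ n) {i : ℕ} (hi : i + 1 < n) {j k : Fin n}
    (hj : i + j.val = k.val) (hk : k.val < n - 1) :
    LineMapsAffinely (xLine hn i) [⟨i, by omega⟩, j] [k] := by
  intro t ht
  have h0 := cast_pos_of_two_le hn
  have hk' : (k : ℝ) + 1 ≤ n - 1 := by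
    rw [← cast_last hn]; exact_mod_cast hk
  have hj' : (i : ℝ) + j = k := by exact_mod_cast hj
  have hj0 : (0 : ℝ) ≤ j := by positivity
  have e : leftEnd [⟨i, by omega⟩, j] + t * (1 / (n : ℝ)) ^ [(⟨i, by omega⟩ : Fin n), j].length
      = (i + (j + t) / n) / n := by
    simp [leftEnd]; field_simp; ring
  have h := (xLine_pieces hn hi (i + (j + t) / n)).2.1
    (by have : 0 ≤ (j + t) / (n : ℝ) := div_nonneg (by linarith [ht.1]) h0.le
        linarith)
    (by gcongr; linarith [ht.2])
  rw [e, h]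
  simp [leftEnd]
  field_simp
  linarith

theorem xLine_at_right (hn : 2 ≤ n) {i : ℕ} (hi : i + 1 < n) {j k : Fin n}
    (hj : i + j.val = n - 1 + k.val) :
    LineMapsAffinely (xLine hn i) [⟨i, by omega⟩, j] [last hn, k] := by
  intro t ht
  have h0 := cast_pos_of_two_le hn
  have hj' : (i : ℝ) + j = n - 1 + k := by
    rw [← cast_last hn]; exact_mod_cast hj
  have hk0 : (0 : ℝ) ≤ k := by positivity
  have hj1 : (j : ℝ) + 1 ≤ n := by exact_mod_cast j.isLt
  have e : leftEnd [⟨i, by omega⟩, j] + t * (1 / (n : ℝ)) ^ [(⟨i, by omega⟩ : Fin n), j].length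
      = (i + (j + t) / n) / n := by
    simp [leftEnd]; field_simp; ring
  have h := (xLine_pieces hn hi (i + (j + t) / n)).2.2.1
    (by gcongr; linarith [ht.1])
    (by have : (j + t) / (n : ℝ) ≤ 1 := by rw [div_le_one h0]; linarith [ht.2]
        linarith)
  rw [e, h]
  simp [leftEnd, cast_last]
  field_simp
  have : (j : ℝ) = n - 1 + k - i := by linarith
  rw [this]
  ring

theorem xLine_gt (hn : 2 ≤ n) {i : ℕ} (hi : i + 1 < n) {m : Fin n} (hm : i < m.val) :
    LineMapsAffinely (xLine hn i) [m] [last hn, m] := by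
  intro t ht
  have h0 := cast_pos_of_two_le hn
  have h := (xLine_pieces hn hi (m + t)).2.2.2 (by
    have : (i : ℝ) + 1 ≤ m := by exact_mod_cast hm
    linarith [ht.1]) (by
    have : (m : ℝ) + 1 ≤ n := by exact_mod_cast m.isLt
    linarith [ht.2])
  have e : leftEnd [m] + t * (1 / (n : ℝ)) ^ [m].length = (m + t) / n := by
    simp [leftEnd]; ring
  rw [e, h]
  simp [leftEnd, cast_last]
  field_simp
  ring

theorem xLine_zero (hn : 2 ≤ n) {i : ℕ} (hi : i + 1 < n) : xLine hn i 0 = 0 := by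
  simpa using (xLine_pieces hn hi 0).1 (by positivity)

theorem xLine_one (hn : 2 ≤ n) {i : ℕ} (hi : i + 1 < n) : xLine hn i 1 = 1 := by
  have h0 := cast_pos_of_two_le hn
  have h := (xLine_pieces hn hi n).2.2.2 (by exact_mod_cast hi.le) le_rfl
  rwa [div_self h0.ne', add_sub_cancel] at h

/-- The copy of `F` on the interval of the last child of the root. -/
noncomputable def lastCopy (hn : 2 ≤ n) (F : ℝ ≃o ℝ) : ℝ ≃o ℝ :=
  (affineIso n (1 - n) (cast_pos_of_two_le hn)).trans
    (F.trans (affineIso n (1 - n) (cast_pos_of_two_le hn)).symm)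

theorem lastCopy_apply (hn : 2 ≤ n) (F : ℝ ≃o ℝ) (x : ℝ) :
    lastCopy hn F x = (F (n * x + (1 - n)) - (1 - n)) / n := rfl

theorem LineMapsAffinely.append {F : ℝ → ℝ} {u v : List (Fin n)} (h : LineMapsAffinely F u v)
    (x : List (Fin n)) : LineMapsAffinely F (u ++ x) (v ++ x) := by
  intro t ht
  have hx := leftEnd_mem x
  have hp : 0 ≤ (1 / (n : ℝ)) ^ x.length := by positivity
  have h1 := mul_le_of_le_one_left hp ht.2
  have h2 := mul_nonneg ht.1 hp
  have := h (leftEnd x + t * (1 / (n : ℝ)) ^ x.length)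
    ⟨by linarith [hx.1], by linarith [hx.2]⟩
  have e : ∀ w : List (Fin n), leftEnd (w ++ x) + t * (1 / (n : ℝ)) ^ (w ++ x).length
      = leftEnd w + (leftEnd x + t * (1 / (n : ℝ)) ^ x.length) * (1 / (n : ℝ)) ^ w.length := by
    intro w
    rw [leftEnd_append, List.length_append, pow_add]
    ring
  rw [e u, e v]
  exact this

theorem LineMapsAffinely.lastCopy (hn : 2 ≤ n) {F : ℝ ≃o ℝ} {u v : List (Fin n)}
    (h : LineMapsAffinely F u v) :
    LineMapsAffinely (lastCopy hn F) (last hn :: u) (last hn :: v) := by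
  intro t ht
  have h0 := cast_pos_of_two_le hn
  have e : ∀ w : List (Fin n), leftEnd (last hn :: w)
      + t * (1 / (n : ℝ)) ^ (last hn :: w).length
      = ((n - 1) + (leftEnd w + t * (1 / (n : ℝ)) ^ w.length)) / n := by
    intro w
    simp only [leftEnd, cast_last, List.length_cons, pow_succ]
    ring
  have e2 : (n : ℝ) * (((n : ℝ) - 1 + (leftEnd u + t * (1 / (n : ℝ)) ^ u.length)) / n) + (1 - n)
      = leftEnd u + t * (1 / (n : ℝ)) ^ u.length := by field_simp; ring
  rw [e, e, lastCopy_apply, e2, h t ht]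
  ring

/-- To the left of the last child of the root the copy of `x_0` is the identity, as `xLine` is the
identity to the left of `0`. -/
theorem lastCopy_xLine_of_nonpos (hn : 2 ≤ n) {x : ℝ} (hx : n * x + (1 - n) ≤ 0) :
    lastCopy hn (xLine hn 0) x = x := by
  have h0 := cast_pos_of_two_le hn
  have h := (xLine_pieces hn (i := 0) (by omega) (n * (n * x + (1 - n)))).1 (by
    simpa using mul_nonpos_of_nonneg_of_nonpos h0.le hx)
  rw [mul_div_cancel_left₀ _ h0.ne'] at h
  rw [lastCopy_apply, h]
  field_simp
  ring

theorem lastCopy_xLine_zero (hn : 2 ≤ n) : lastCopy hn (xLine hn 0) 0 = 0 := by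
  have h2 : (2 : ℝ) ≤ n := by exact_mod_cast hn
  exact lastCopy_xLine_of_nonpos hn (by linarith)

theorem lastCopy_xLine_one (hn : 2 ≤ n) : lastCopy hn (xLine hn 0) 1 = 1 := by
  have h0 := cast_pos_of_two_le hn
  rw [lastCopy_apply, show (n : ℝ) * 1 + (1 - n) = 1 by ring, xLine_one hn (by omega)]
  field_simp
  ring

theorem lastCopy_xLine_lt (hn : 2 ≤ n) {m : Fin n} (hm : m.val < n - 1) :
    LineMapsAffinely (lastCopy hn (xLine hn 0)) [m] [m] := by
  intro t ht
  have h0 := cast_pos_of_two_le hn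
  have hm' : (m : ℝ) + 1 ≤ n - 1 := by
    rw [← cast_last hn]; exact_mod_cast hm
  apply lastCopy_xLine_of_nonpos hn
  have e : (n : ℝ) * (leftEnd [m] + t * (1 / (n : ℝ)) ^ [m].length) = m + t := by
    simp [leftEnd]; field_simp
  rw [e]
  linarith [ht.2]

/-- The generator `x_i`, `i ≤ n - 1`, as a homeomorphism of the circle.  For `i = n - 1` it is the
copy of `x_0` on the interval of the last child of the root. -/
noncomputable def xHomeo (hn : 2 ≤ n) (i : ℕ) : UCircle ≃ₜ UCircle :=
  if hi : i + 1 < n then circleHomeo (xLine hn i) (xLine_zero hn hi) (xLine_one hn hi)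
  else circleHomeo (lastCopy hn (xLine hn 0)) (lastCopy_xLine_zero hn) (lastCopy_xLine_one hn)

theorem xHomeo_zero (hn : 2 ≤ n) (i : ℕ) : xHomeo hn i 0 = 0 := by
  have key : ∀ (F : ℝ ≃o ℝ) (h0 : F 0 = 0) (h1 : F 1 = 1), circleHomeo F h0 h1 0 = 0 := by
    intro F h0 h1
    have := circleHomeo_coe h0 h1 (x := 0) ⟨le_rfl, zero_le_one⟩
    rw [h0] at this
    simpa using this
  unfold xHomeo
  split_ifs <;> apply key

/-- The generator `c_0` as a homeomorphism of the circle: the rotation by `-1 / n`. -/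
noncomputable def cHomeo (n : ℕ) : UCircle ≃ₜ UCircle :=
  Homeomorph.addRight ((-(1 / (n : ℝ)) : ℝ) : UCircle)

theorem cHomeo_coe (x : ℝ) : cHomeo n (x : UCircle) = ((x - 1 / n : ℝ) : UCircle) := by
  rw [sub_eq_add_neg, AddCircle.coe_add]
  rfl

theorem cHomeo_finRotate (hn : 2 ≤ n) (j : Fin n) :
    MapsAffinely (cHomeo n) [finRotate n j] [j] := by
  obtain ⟨m, rfl⟩ : ∃ m, n = m + 1 := ⟨n - 1, by omega⟩
  intro t ht
  rw [cHomeo_coe]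
  rcases eq_or_ne j (Fin.last m) with rfl | hj
  · rw [finRotate_last]
    have e : leftEnd [Fin.last m] + t * (1 / ((m + 1 : ℕ) : ℝ)) ^ [Fin.last m].length
        = leftEnd [(0 : Fin (m + 1))] + t * (1 / ((m + 1 : ℕ) : ℝ)) ^ [(0 : Fin (m + 1))].length
          - 1 / ((m + 1 : ℕ) : ℝ) + 1 := by
      simp [leftEnd]; field_simp; ring
    rw [e, AddCircle.coe_add, AddCircle.coe_period, add_zero]
  · have hv : ((finRotate (m + 1) j : Fin (m + 1)) : ℕ) = j + 1 := by
      rw [coe_finRotate_of_ne_last hj]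
    congr 1
    simp only [leftEnd, hv, List.length_singleton]
    push_cast
    ring

/-! ### The right spine and the action of the generators on it -/

/-- The `s`-th vertex of the right spine. -/
def spine (hn : 2 ≤ n) (s : ℕ) : List (Fin n) := List.replicate s (last hn)

/-- The addresses `0, 1, …, n - 2, (n - 1)0, (n - 1)1, …` of the children that hang off the right
spine, numbered from left to right by the natural numbers.  Their intervals cover `[0, 1)`. -/
def pos (hn : 2 ≤ n) (m : ℕ) : List (Fin n) :=
  spine hn (m / (n - 1)) ++
    [⟨m % (n - 1), (Nat.mod_lt _ (by omega : 0 < n - 1)).trans_le (Nat.sub_le _ _)⟩]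

theorem spine_succ (hn : 2 ≤ n) (s : ℕ) : spine hn (s + 1) = last hn :: spine hn s := rfl

theorem pos_of_lt (hn : 2 ≤ n) {m : ℕ} (hm : m < n - 1) : pos hn m = [⟨m, by omega⟩] := by
  simp [pos, spine, Nat.div_eq_of_lt hm, Nat.mod_eq_of_lt hm]

theorem pos_val (hn : 2 ≤ n) {m : Fin n} (hm : m.val < n - 1) : pos hn m.val = [m] :=
  pos_of_lt hn hm

theorem pos_add (hn : 2 ≤ n) (m : ℕ) : pos hn (m + (n - 1)) = last hn :: pos hn m := by
  have h : 0 < n - 1 := by omega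
  simp [pos, Nat.add_div_right _ h, spine_succ]

/-- `g` expands position `j`: it spreads the children of position `j` over the positions
`j, …, j + n - 1`, fixes `0` and the positions before `j`, and
moves those after `j`, as well as the vertices of the spine beyond them, one step along the
spine. -/
structure Expands (hn : 2 ≤ n) (g : UCircle ≃ₜ UCircle) (j : ℕ) : Prop where
  lt : ∀ m < j, MapsAffinely g (pos hn m) (pos hn m)
  children : ∀ i : Fin n, MapsAffinely g (pos hn j ++ [i]) (pos hn (j + i))
  gt : ∀ m, j < m → MapsAffinely g (pos hn m) (pos hn (m + (n - 1)))
  spine : ∀ s, j < (n - 1) * s → MapsAffinely g (spine hn s) (spine hn (s + 1))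
  zero : g 0 = 0

theorem xHomeo_lt (hn : 2 ≤ n) {i : ℕ} (hi : i ≤ n - 1) {m : Fin n} (hm : m.val < i) :
    MapsAffinely (xHomeo hn i) [m] [m] := by
  unfold xHomeo
  split_ifs with h
  · exact (xLine_lt hn h hm).mapsAffinely _ _
  · exact (lastCopy_xLine_lt hn (by omega)).mapsAffinely _ _

theorem xHomeo_at_left (hn : 2 ≤ n) {i : ℕ} (hi : i + 1 < n) {j k : Fin n}
    (hj : i + j.val = k.val) (hk : k.val < n - 1) :
    MapsAffinely (xHomeo hn i) [⟨i, by omega⟩, j] [k] := by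
  rw [xHomeo, dif_pos hi]
  exact (xLine_at_left hn hi hj hk).mapsAffinely _ _

theorem xHomeo_at_right (hn : 2 ≤ n) {i : ℕ} (hi : i + 1 < n) {j k : Fin n}
    (hj : i + j.val = n - 1 + k.val) :
    MapsAffinely (xHomeo hn i) [⟨i, by omega⟩, j] [last hn, k] := by
  rw [xHomeo, dif_pos hi]
  exact (xLine_at_right hn hi hj).mapsAffinely _ _

theorem xHomeo_gt (hn : 2 ≤ n) {i : ℕ} (hi : i + 1 < n) {m : Fin n} (hm : i < m.val) :
    MapsAffinely (xHomeo hn i) [m] [last hn, m] := by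
  rw [xHomeo, dif_pos hi]
  exact (xLine_gt hn hi hm).mapsAffinely _ _

theorem xHomeo_last (hn : 2 ≤ n) {u v : List (Fin n)} (h : LineMapsAffinely (xLine hn 0) u v) :
    MapsAffinely (xHomeo hn (n - 1)) (last hn :: u) (last hn :: v) := by
  rw [xHomeo, dif_neg (by omega)]
  exact (h.lastCopy hn).mapsAffinely _ _

theorem expands_xHomeo_of_lt (hn : 2 ≤ n) {i : ℕ} (hi : i + 1 < n) :
    Expands hn (xHomeo hn i) i where
  lt m hm := by
    rw [pos_of_lt hn (by omega)]
    exact xHomeo_lt hn (by omega) hm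
  children k := by
    rw [pos_of_lt hn (by omega)]
    rcases lt_or_ge (i + k.val) (n - 1) with h | h
    · rw [pos_of_lt hn h]
      exact xHomeo_at_left hn hi rfl h
    · obtain ⟨l, hl⟩ := Nat.exists_eq_add_of_le' h
      rw [hl, pos_add, pos_of_lt hn (by omega)]
      exact xHomeo_at_right hn hi (k := ⟨l, by omega⟩) (by simp; omega)
  gt m hm := by
    rw [pos_add]
    rcases lt_or_ge m (n - 1) with h | h
    · rw [pos_of_lt hn h]
      exact xHomeo_gt hn hi hm
    · obtain ⟨l, rfl⟩ := Nat.exists_eq_add_of_le' h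
      rw [pos_add]
      exact (xHomeo_gt hn hi (m := last hn) (by simp [last]; omega)).append _
  zero := xHomeo_zero hn i
  spine s hs := by
    obtain ⟨s, rfl⟩ : ∃ t, s = t + 1 := ⟨s - 1, by
      have : s ≠ 0 := by rintro rfl; simp at hs
      omega⟩
    rw [spine_succ, spine_succ, spine_succ]
    exact (xHomeo_gt hn hi (m := last hn) (by simp [last]; omega)).append _

theorem expands_xHomeo_last (hn : 2 ≤ n) : Expands hn (xHomeo hn (n - 1)) (n - 1) where
  lt m hm := by
    rw [pos_of_lt hn hm]
    exact xHomeo_lt hn le_rfl hm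
  children k := by
    have e : pos hn (n - 1) = [last hn, ⟨0, by omega⟩] := by
      have := pos_add hn 0
      rwa [zero_add, pos_of_lt hn (m := 0) (by omega)] at this
    rw [e, add_comm, pos_add]
    apply xHomeo_last
    rcases lt_or_ge k.val (n - 1) with h | h
    · rw [pos_val hn h]
      exact xLine_at_left hn (by omega) (zero_add _) h
    · have hk : k.val = 0 + (n - 1) := by omega
      rw [hk, pos_add, pos_of_lt hn (by omega)]
      exact xLine_at_right hn (by omega) (by simp; omega)
  gt m hm := by
    obtain ⟨l, rfl⟩ := Nat.exists_eq_add_of_le' hm.le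
    have hl : 0 < l := by omega
    rw [pos_add, pos_add, pos_add]
    apply xHomeo_last
    rcases lt_or_ge l (n - 1) with h | h
    · rw [pos_of_lt hn h]
      exact xLine_gt hn (by omega) hl
    · obtain ⟨l, rfl⟩ := Nat.exists_eq_add_of_le' h
      rw [pos_add]
      exact (xLine_gt hn (by omega) (m := last hn)
        (by simp [last]; omega)).append _
  zero := xHomeo_zero hn _
  spine s hs := by
    obtain ⟨s, rfl⟩ : ∃ t, s = t + 2 := ⟨s - 2, by
      have h0 : s ≠ 0 := by rintro rfl; simp at hs
      have h1 : s ≠ 1 := by rintro rfl; simp at hs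
      omega⟩
    rw [spine_succ hn (s + 2), spine_succ hn (s + 1), spine_succ]
    apply xHomeo_last
    exact (xLine_gt hn (by omega) (m := last hn) (by simp [last]; omega)).append _

theorem expands_xHomeo (hn : 2 ≤ n) {i : ℕ} (hi : i ≤ n - 1) : Expands hn (xHomeo hn i) i := by
  rcases lt_or_ge (i + 1) n with h | h
  · exact expands_xHomeo_of_lt hn h
  · obtain rfl : i = n - 1 := by omega
    exact expands_xHomeo_last hn

theorem inv_zero_of_zero {g : UCircle ≃ₜ UCircle} (h : g 0 = 0) : g⁻¹ 0 = 0 := by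
  conv_lhs => rw [← h]
  exact g.symm_apply_apply 0

/-- Conjugation by `x_0` moves the position that is expanded by `n - 1`. -/
theorem Expands.conj (hn : 2 ≤ n) {g x : UCircle ≃ₜ UCircle} {j : ℕ} (hx : Expands hn x 0)
    (hg : Expands hn g j) (hj : 0 < j) : Expands hn (x * g * x⁻¹) (j + (n - 1)) where
  lt m hm := by
    rcases lt_or_ge m n with h | h
    · have h1 := hx.children ⟨m, h⟩
      rw [zero_add] at h1
      exact h1.symm.comp (((hg.lt 0 hj).append _).comp h1)
    · obtain ⟨l, rfl⟩ := Nat.exists_eq_add_of_le' (show n - 1 ≤ m by omega)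
      have h1 := hx.gt l (by omega)
      exact h1.symm.comp ((hg.lt l (by omega)).comp h1)
  children i := by
    have h1 := (hx.gt j hj).append [i]
    have h2 := hx.gt (j + i) (by omega)
    rw [show j + (n - 1) + i.val = j + i + (n - 1) by omega]
    exact h1.symm.comp ((hg.children i).comp h2)
  gt m hm := by
    obtain ⟨l, rfl⟩ := Nat.exists_eq_add_of_le' (show n - 1 ≤ m by omega)
    exact (hx.gt l (by omega)).symm.comp ((hg.gt l (by omega)).comp (hx.gt _ (by omega)))
  zero := by
    rw [Homeomorph.mul_apply, Homeomorph.mul_apply, (inv_zero_of_zero hx.zero), hg.zero, hx.zero]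
  spine s hs := by
    obtain ⟨s, rfl⟩ : ∃ t, s = t + 1 := ⟨s - 1, by
      have : s ≠ 0 := by rintro rfl; simp at hs
      omega⟩
    rw [mul_add, mul_one] at hs
    refine (hx.spine s (by omega)).symm.comp ((hg.spine s (by omega)).comp (hx.spine _ ?_))
    rw [mul_add]
    omega

/-- The conjugates of `x_r` by powers of `x_0` expand the positions `r + (n - 1) q`.  For `r = 0`
the conjugation is trivial, so this case is confined to `q = 0`. -/
theorem expands_conj_pow (hn : 2 ≤ n) (q : ℕ) {r : ℕ} (hr : r ≤ n - 1) (h : 0 < r ∨ q = 0) :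
    Expands hn (xHomeo hn 0 ^ q * xHomeo hn r * (xHomeo hn 0 ^ q)⁻¹) (r + (n - 1) * q) := by
  induction q with
  | zero => simpa using expands_xHomeo hn hr
  | succ q ih =>
    have hr0 : 0 < r := by omega
    have := (expands_xHomeo hn (Nat.zero_le _)).conj hn (ih (Or.inl hr0)) (by omega)
    rw [mul_add, mul_one, ← add_assoc, pow_succ']
    convert this using 1
    group

/-! ### The generating set -/

theorem mem_leaves_hang {j : ℕ} {t : NTree n} {w : List (Fin n)} :
    w ∈ (NTree.hang j t).leaves ↔
      (∃ i : Fin n, i.val = j ∧ ∃ x ∈ t.leaves, w = i :: x) ∨ ∃ i : Fin n, i.val ≠ j ∧ w = [i] := by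
  rw [NTree.hang, NTree.mem_leaves_node]
  constructor
  · rintro ⟨i, x, hx, rfl⟩
    by_cases h : i.val = j
    · rw [if_pos h] at hx
      exact Or.inl ⟨i, h, x, hx, rfl⟩
    · rw [if_neg h] at hx
      simp only [NTree.leaves, List.mem_singleton] at hx
      exact Or.inr ⟨i, h, by rw [hx]⟩
  · rintro (⟨i, h, x, hx, rfl⟩ | ⟨i, h, rfl⟩)
    · exact ⟨i, x, by rwa [if_pos h], rfl⟩
    · exact ⟨i, [], by simp [h, NTree.leaves], rfl⟩

theorem mem_leaves_caret {w : List (Fin n)} : w ∈ (NTree.caret n).leaves ↔ ∃ i, w = [i] := by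
  simp [NTree.caret, NTree.leaves]

/-- The leaves of the comb with two carets along the right spine. -/
theorem mem_leaves_rightComb_two (hn : 2 ≤ n) {w : List (Fin n)} :
    w ∈ (NTree.hang (n - 1) (NTree.caret n)).leaves ↔
      (∃ k, w = [last hn, k]) ∨ ∃ k : Fin n, k.val < n - 1 ∧ w = [k] := by
  rw [mem_leaves_hang]
  simp only [mem_leaves_caret]
  constructor
  · rintro (⟨i, hi, _, ⟨k, rfl⟩, rfl⟩ | ⟨i, hi, rfl⟩)
    · obtain rfl : i = last hn := Fin.ext hi
      exact Or.inl ⟨k, rfl⟩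
    · exact Or.inr ⟨i, by omega, rfl⟩
  · rintro (⟨k, rfl⟩ | ⟨i, hi, rfl⟩)
    · exact Or.inl ⟨last hn, rfl, _, ⟨k, rfl⟩, rfl⟩
    · exact Or.inr ⟨i, by omega, rfl⟩

theorem exists_leaf_xLine (hn : 2 ≤ n) {i : ℕ} (hi : i + 1 < n) {u : List (Fin n)}
    (hu : u ∈ (NTree.hang i (NTree.caret n)).leaves) :
    ∃ v ∈ (NTree.hang (n - 1) (NTree.caret n)).leaves, LineMapsAffinely (xLine hn i) u v := by
  simp only [mem_leaves_rightComb_two hn]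
  rcases mem_leaves_hang.1 hu with ⟨l, hl, x, hx, rfl⟩ | ⟨m, hm, rfl⟩
  · obtain ⟨j, rfl⟩ := mem_leaves_caret.1 hx
    subst hl
    rcases lt_or_ge (l.val + j.val) (n - 1) with h | h
    · exact ⟨_, Or.inr ⟨⟨l.val + j, by omega⟩, h, rfl⟩, xLine_at_left hn hi rfl h⟩
    · exact ⟨_, Or.inl ⟨⟨l.val + j - (n - 1), by omega⟩, rfl⟩,
        xLine_at_right hn hi (by simp; omega)⟩
  · rcases lt_or_gt_of_ne hm with h | h
    · exact ⟨_, Or.inr ⟨m, by omega, rfl⟩, xLine_lt hn hi h⟩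
    · exact ⟨_, Or.inl ⟨m, rfl⟩, xLine_gt hn hi h⟩

theorem takesSubdivision_xHomeo (hn : 2 ≤ n) (i : Fin n) :
    TakesSubdivision (xHomeo hn i) (TreePair.x hn i).source (TreePair.x hn i).target := by
  apply takesSubdivision_of_forall hn
  · exact carets_eq_of_length_eq hn (TreePair.x hn i).length_eq
  · intro u hu
    by_cases h : i.val < n - 1
    · have hi : i.val + 1 < n := by omega
      simp only [TreePair.x, if_pos h] at hu ⊢
      obtain ⟨v, hv, huv⟩ := exists_leaf_xLine hn hi hu
      refine ⟨v, hv, ?_⟩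
      rw [xHomeo, dif_pos hi]
      exact huv.mapsAffinely _ _
    · simp only [TreePair.x, if_neg h] at hu ⊢
      have hi : i.val = n - 1 := by omega
      rw [hi]
      rcases mem_leaves_hang.1 hu with ⟨l, hl, x, hx, rfl⟩ | ⟨m, hm, rfl⟩
      · obtain ⟨v, hv, huv⟩ := exists_leaf_xLine hn (by omega) hx
        obtain rfl : l = last hn := Fin.ext hl
        exact ⟨_, mem_leaves_hang.2 (Or.inl ⟨last hn, rfl, v, hv, rfl⟩), xHomeo_last hn huv⟩
      · exact ⟨_, mem_leaves_hang.2 (Or.inr ⟨m, hm, rfl⟩), xHomeo_lt hn le_rfl (by omega)⟩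

theorem x_represents_xHomeo (hn : 2 ≤ n) (i : Fin n) :
    (TreePair.x hn i).Represents (xHomeo hn i) := by
  refine represents_of_takesSubdivision hn (takesSubdivision_xHomeo hn i) ?_
  have h : (TreePair.x hn i).shift = 0 := rfl
  simp only [h]
  rw [xHomeo_zero, leftEnd_leaves_zero hn]
  rfl

/-- `c_0` rotates the children of the root. -/
theorem takesSubdivision_cHomeo (hn : 2 ≤ n) (c : Fin n → NTree n) :
    TakesSubdivision (cHomeo n) (.node c) (.node (c ∘ finRotate n)) := by
  constructor
  · intro u hu
    obtain ⟨i, x, hx, rfl⟩ := NTree.mem_leaves_node.1 hu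
    obtain ⟨j, rfl⟩ := (finRotate n).surjective i
    exact ⟨j :: x, NTree.mem_leaves_node.2 ⟨j, x, hx, rfl⟩, (cHomeo_finRotate hn j).append x⟩
  · intro u hu
    obtain ⟨j, x, hx, rfl⟩ := NTree.mem_leaves_node.1 hu
    exact ⟨finRotate n j :: x, NTree.mem_leaves_node.2 ⟨_, x, hx, rfl⟩,
      (cHomeo_finRotate hn j).append x⟩

theorem leaves_caret : (NTree.caret n).leaves = (List.finRange n).map fun i => [i] := by
  simp [NTree.caret, NTree.leaves, List.map_eq_flatMap]

theorem c₀_represents_cHomeo (hn : 2 ≤ n) : (TreePair.c₀ hn).Represents (cHomeo n) := by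
  refine represents_of_takesSubdivision hn (takesSubdivision_cHomeo hn _) ?_
  have h0 := cast_pos_of_two_le hn
  simp only [TreePair.c₀, leaves_caret, List.getElem_map, List.getElem_finRange]
  have e : leftEnd [(⟨n - 1, by omega⟩ : Fin n)] = (0 - 1 / n) + 1 := by
    have := cast_last hn
    simp only [last] at this
    simp only [leftEnd, this]
    field_simp
    ring
  have h := cHomeo_coe (n := n) 0
  rw [show ((0 : ℝ) : UCircle) = 0 from rfl] at h
  rw [h]
  simp only [Fin.cast_mk]
  -- The label `0` moves to the last leaf: on the circle, `-1 / n` is `(n - 1) / n`.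
  rw [e, AddCircle.coe_add, AddCircle.coe_period, add_zero]

/-- The generator `x_i` as an element of `T_n`. -/
noncomputable def xElt (hn : 2 ≤ n) (i : Fin n) : ThompsonT n hn :=
  ⟨xHomeo hn i, _, _, takesSubdivision_xHomeo hn i⟩

/-- The generator `c_0` as an element of `T_n`. -/
noncomputable def cElt (hn : 2 ≤ n) : ThompsonT n hn :=
  ⟨cHomeo n, _, _, takesSubdivision_cHomeo hn fun _ => .leaf⟩

theorem xElt_mem (hn : 2 ≤ n) (i : Fin n) : xElt hn i ∈ generatorsT n hn :=
  Or.inl ⟨i, x_represents_xHomeo hn i⟩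

theorem cElt_mem (hn : 2 ≤ n) : cElt hn ∈ generatorsT n hn :=
  Or.inr (c₀_represents_cHomeo hn)

/-! ### Balls in the word metric -/

/-- `g` is a product of at most `k` elements of `S` and their inverses. -/
def Reach {G : Type*} [Group G] (S : Set G) (k : ℕ) (g : G) : Prop :=
  ∃ l : List G, (∀ s ∈ l, s ∈ S ∨ s⁻¹ ∈ S) ∧ l.prod = g ∧ l.length ≤ k

namespace Reach

variable {G : Type*} [Group G] {S : Set G} {k l : ℕ} {g h : G}

theorem one : Reach S 0 (1 : G) := ⟨[], by simp, rfl, le_rfl⟩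

theorem of_mem (hg : g ∈ S) : Reach S 1 g := ⟨[g], by simp [hg], by simp, le_rfl⟩

theorem mono (hg : Reach S k g) (hkl : k ≤ l) : Reach S l g := by
  obtain ⟨w, h1, h2, h3⟩ := hg
  exact ⟨w, h1, h2, h3.trans hkl⟩

theorem mul (hg : Reach S k g) (hh : Reach S l h) : Reach S (k + l) (g * h) := by
  obtain ⟨w, h1, rfl, h3⟩ := hg
  obtain ⟨w', h1', rfl, h3'⟩ := hh
  refine ⟨w ++ w', fun s hs => ?_, List.prod_append, by rw [List.length_append]; omega⟩
  rcases List.mem_append.1 hs with hs | hs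
  · exact h1 s hs
  · exact h1' s hs

theorem inv (hg : Reach S k g) : Reach S k g⁻¹ := by
  obtain ⟨w, h1, rfl, h3⟩ := hg
  refine ⟨(w.map (·⁻¹)).reverse, fun s hs => ?_, (List.prod_inv_reverse w).symm, by simpa⟩
  obtain ⟨t, ht, rfl⟩ : ∃ t ∈ w, t⁻¹ = s := by simpa using hs
  rw [inv_inv]
  exact (h1 t ht).symm

theorem pow (hg : Reach S k g) (m : ℕ) : Reach S (m * k) (g ^ m) := by
  induction m with
  | zero => simpa using one
  | succ m ih => rw [pow_succ, add_mul, one_mul]; exact ih.mul hg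

theorem wordLength_le (hg : Reach S k g) : wordLength S g ≤ k := by
  obtain ⟨w, h1, h2, h3⟩ := hg
  exact (Nat.sInf_le (s := {k | ∃ l : List G, (∀ s ∈ l, s ∈ S ∨ s⁻¹ ∈ S) ∧ l.prod = g ∧
    l.length = k}) ⟨w, h1, h2, rfl⟩).trans h3

theorem mem_closure (hg : Reach S k g) : g ∈ Subgroup.closure S := by
  obtain ⟨w, h1, rfl, -⟩ := hg
  refine Subgroup.list_prod_mem _ fun s hs => ?_
  rcases h1 s hs with h | h
  · exact Subgroup.subset_closure h
  · simpa using inv_mem (Subgroup.subset_closure h)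

/-- The word length is attained as soon as there is any word at all. -/
theorem reach_wordLength (hg : Reach S k g) : Reach S (wordLength S g) g := by
  obtain ⟨w, h1, h2, h3⟩ := hg
  obtain ⟨w', h1', h2', h3'⟩ := Nat.sInf_mem (s := {k | ∃ l : List G,
    (∀ s ∈ l, s ∈ S ∨ s⁻¹ ∈ S) ∧ l.prod = g ∧ l.length = k}) ⟨_, w, h1, h2, rfl⟩
  exact ⟨w', h1', h2', h3'.le⟩

end Reach

/-! ### Forests on the right spine -/

/-- The number of carets of a forest. -/
def forestCarets (F : List (NTree n)) : ℕ := (F.map NTree.carets).sum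

theorem forestCarets_cons (t : NTree n) (F : List (NTree n)) :
    forestCarets (t :: F) = t.carets + forestCarets F := by simp [forestCarets]

theorem forestCarets_append (F F' : List (NTree n)) :
    forestCarets (F ++ F') = forestCarets F + forestCarets F' := by simp [forestCarets]

/-- `g` straightens the forest whose trees hang at the positions `j, j + 1, …` of the right spine:
it takes the leaves of the forest to positions on the spine, fixes `0` and what comes before the
forest, and
moves the spine beyond the forest along itself. -/
structure Straightens (hn : 2 ≤ n) (g : UCircle ≃ₜ UCircle) (F : List (NTree n)) (j : ℕ) :
    Prop where
  lt : ∀ m < j, MapsAffinely g (pos hn m) (pos hn m)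
  leaf : ∀ p t, F[p]? = some t → ∀ w ∈ t.leaves,
    ∃ m < j + F.length + (n - 1) * forestCarets F, MapsAffinely g (pos hn (j + p) ++ w) (pos hn m)
  spine : ∀ s, j + F.length ≤ (n - 1) * s →
    MapsAffinely g (spine hn s) (spine hn (s + forestCarets F))
  zero : g 0 = 0

theorem straightens_nil (hn : 2 ≤ n) (j : ℕ) : Straightens hn 1 [] j where
  lt m _ := mapsAffinely_one _
  leaf p t h := by simp at h
  spine s _ := mapsAffinely_one _
  zero := rfl

theorem Straightens.cons_leaf {hn : 2 ≤ n} {g : UCircle ≃ₜ UCircle} {F : List (NTree n)} {j : ℕ}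
    (h : Straightens hn g F (j + 1)) : Straightens hn g (.leaf :: F) j := by
  have hc : forestCarets (.leaf :: F) = forestCarets F := by
    simp [forestCarets_cons, NTree.carets]
  refine ⟨fun m hm => h.lt m (by omega), fun p t hp w hw => ?_, fun s hs => ?_, h.zero⟩
  · rw [hc, List.length_cons]
    cases p with
    | zero =>
      obtain rfl : NTree.leaf = t := by simpa using hp
      obtain rfl : w = [] := by simpa [NTree.leaves] using hw
      exact ⟨j, by omega, by simpa using h.lt j (by omega)⟩
    | succ p =>
      obtain ⟨m, hm, hg⟩ := h.leaf p t (by simpa using hp) w hw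
      exact ⟨m, by omega, by rwa [show j + (p + 1) = j + 1 + p by omega]⟩
  · rw [hc]
    rw [List.length_cons] at hs
    exact h.spine s (by omega)

theorem forestCarets_ofFn (d : Fin n → NTree n) :
    forestCarets (List.ofFn d) + 1 = (NTree.node d).carets := by
  simp [forestCarets, NTree.carets, List.sum_ofFn, add_comm]

theorem Straightens.cons_node {hn : 2 ≤ n} {g x : UCircle ≃ₜ UCircle} {F : List (NTree n)} {j : ℕ}
    {d : Fin n → NTree n} (h : Straightens hn g (List.ofFn d ++ F) j) (hx : Expands hn x j) :
    Straightens hn (g * x) (.node d :: F) j := by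
  have hc : forestCarets (.node d :: F) = forestCarets (List.ofFn d ++ F) + 1 := by
    rw [forestCarets_append, forestCarets_cons, ← forestCarets_ofFn]; omega
  have hl : (List.ofFn d ++ F).length = F.length + n := by simp; omega
  refine ⟨fun m hm => (hx.lt m hm).comp (h.lt m hm), fun p t hp w hw => ?_, fun s hs => ?_,
    by rw [Homeomorph.mul_apply, hx.zero, h.zero]⟩
  · rw [hc, List.length_cons, mul_add, mul_one]
    cases p with
    | zero =>
      obtain rfl : NTree.node d = t := by simpa using hp
      obtain ⟨i, x, hx', rfl⟩ := NTree.mem_leaves_node.1 hw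
      obtain ⟨m, hm, hg⟩ := h.leaf i (d i)
        (by rw [List.getElem?_append_left (by simp)]; simp) x hx'
      have := ((hx.children i).append x).comp hg
      exact ⟨m, by omega, by simpa using this⟩
    | succ p =>
      obtain ⟨m, hm, hg⟩ := h.leaf (p + n) t (by
        rw [List.getElem?_append_right (by simp)]
        simpa using hp) w hw
      have h1 := (hx.gt (j + (p + 1)) (by omega)).append w
      rw [show j + (p + 1) + (n - 1) = j + (p + n) by omega] at h1
      exact ⟨m, by omega, h1.comp hg⟩
  · rw [List.length_cons] at hs
    have h1 := h.spine (s + 1) (by rw [mul_add]; omega)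
    rw [hc, show s + (forestCarets (List.ofFn d ++ F) + 1)
      = s + 1 + forestCarets (List.ofFn d ++ F) by omega]
    exact (hx.spine s (by omega)).comp h1

/-- The generator `x_0` as an element of `T_n`. -/
noncomputable def xZero (hn : 2 ≤ n) : ThompsonT n hn := xElt hn ⟨0, by omega⟩

/-- Every position `j` is expanded by a conjugate of some `x_r` by a power of `x_0`.  The exponent
is `0` for `j = 0`, by truncated subtraction. -/
theorem expands_conj_xElt (hn : 2 ≤ n) (j : ℕ) : ∃ r : Fin n,
    Expands hn ((xZero hn ^ ((j - 1) / (n - 1)) * xElt hn r * (xZero hn ^ ((j - 1) / (n - 1)))⁻¹ :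
      ThompsonT n hn) : UCircle ≃ₜ UCircle) j := by
  have h0 : 0 < n - 1 := by omega
  have hdm := Nat.div_add_mod (j - 1) (n - 1)
  have hm := Nat.mod_lt (j - 1) h0
  generalize hq : (j - 1) / (n - 1) = q at hdm ⊢
  generalize (j - 1) % (n - 1) = r at hdm hm
  rcases Nat.eq_zero_or_pos j with rfl | hj
  · obtain rfl : q = 0 := by rw [← hq]; simp
    exact ⟨⟨0, by omega⟩, expands_conj_pow hn 0 (Nat.zero_le _) (Or.inr rfl)⟩
  · refine ⟨⟨r + 1, by omega⟩, ?_⟩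
    have := expands_conj_pow hn q (r := r + 1) (by omega) (Or.inl (by omega))
    rw [show r + 1 + (n - 1) * q = j by omega] at this
    exact this

/-- A forest is straightened by expanding its carets from left to right.  Position `j` is expanded
by a conjugate of some `x_r` by a power of `x_0`, and consecutive powers of `x_0` cancel up to the
amount by which the position moves; hence the word needs one letter for every caret and a number of
letters `x_0^{±1}` that is linear in the last position. -/
theorem exists_straightens (hn : 2 ≤ n) (N : ℕ) : ∀ (F : List (NTree n)) (j : ℕ),
    n * forestCarets F + F.length = N → ∃ g : ThompsonT n hn, Straightens hn g F j ∧
      ∃ k, Reach (generatorsT n hn) k (g * xZero hn ^ ((j - 1) / (n - 1))) ∧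
        k + (j - 1) / (n - 1) ≤ forestCarets F
          + 2 * ((j + F.length + (n - 1) * forestCarets F - 1) / (n - 1)) := by
  have hx0 : Reach (generatorsT n hn) 1 (xZero hn) := Reach.of_mem (xElt_mem hn _)
  -- Dropping a leaf shortens the forest by one tree; expanding a caret replaces one tree by `n`,
  -- but removes a caret, which counts `n`.
  induction N with
  | zero =>
    intro F j hF
    obtain rfl : F = [] := List.length_eq_zero_iff.1 (by omega)
    refine ⟨1, straightens_nil hn j, (j - 1) / (n - 1), ?_, ?_⟩
    · simpa using hx0.pow ((j - 1) / (n - 1))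
    · simp [forestCarets]; omega
  | succ N ih =>
    intro F j hF
    rcases F with _ | ⟨_ | d, F⟩
    · simp [forestCarets] at hF
    · have hc : forestCarets (.leaf :: F) = forestCarets F := by
        simp [forestCarets_cons, NTree.carets]
      rw [hc, List.length_cons] at hF
      obtain ⟨g, hg, k, hk, hle⟩ := ih F (j + 1) (by omega)
      refine ⟨g, hg.cons_leaf, k + ((j + 1 - 1) / (n - 1) - (j - 1) / (n - 1)), ?_, ?_⟩
      · have hQ : (j - 1) / (n - 1) ≤ (j + 1 - 1) / (n - 1) := Nat.div_le_div_right (by omega)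
        have := hk.mul (hx0.pow ((j + 1 - 1) / (n - 1) - (j - 1) / (n - 1))).inv
        rw [mul_one] at this
        convert this using 1
        rw [mul_assoc]
        congr 1
        rw [eq_mul_inv_iff_mul_eq, ← pow_add]
        congr 1
        omega
      · have hQ : (j - 1) / (n - 1) ≤ (j + 1 - 1) / (n - 1) := Nat.div_le_div_right (by omega)
        rw [hc, List.length_cons, show j + (F.length + 1) = j + 1 + F.length by omega]
        omega
    · have hc : forestCarets (.node d :: F) = forestCarets (List.ofFn d ++ F) + 1 := by
        rw [forestCarets_append, forestCarets_cons, ← forestCarets_ofFn]; omega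
      have hl : (List.ofFn d ++ F).length = F.length + n := by simp; omega
      rw [hc, List.length_cons, mul_add] at hF
      obtain ⟨g, hg, k, hk, hle⟩ := ih (List.ofFn d ++ F) j (by omega)
      obtain ⟨r, hr⟩ := expands_conj_xElt hn j
      refine ⟨g * _, hg.cons_node hr, k + 1, ?_, ?_⟩
      · have := hk.mul (Reach.of_mem (xElt_mem hn r))
        convert this using 1
        group
      · rw [hc, List.length_cons, mul_add, mul_one]
        rw [hl] at hle
        rw [show j + (F.length + 1) + ((n - 1) * forestCarets (List.ofFn d ++ F) + (n - 1))
          = j + (F.length + n) + (n - 1) * forestCarets (List.ofFn d ++ F) by omega]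
        omega

/-! ### Straightening a tree -/

/-- The comb with `N` carets along the right spine. -/
def comb (n : ℕ) : ℕ → NTree n
  | 0 => .leaf
  | N + 1 => .hang (n - 1) (comb n N)

theorem carets_comb (hn : 2 ≤ n) (N : ℕ) : (comb n N).carets = N := by
  induction N with
  | zero => rfl
  | succ N ih => rw [comb, NTree.carets_hang (by omega), ih, add_comm]

theorem mem_leaves_comb (hn : 2 ≤ n) (N : ℕ) {w : List (Fin n)} :
    w ∈ (comb n N).leaves ↔ w = spine hn N ∨ ∃ m < (n - 1) * N, w = pos hn m := by
  induction N generalizing w with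
  | zero => simp [comb, NTree.leaves, spine]
  | succ N ih =>
    rw [comb, mem_leaves_hang]
    simp only [ih, mul_add, mul_one]
    constructor
    · rintro (⟨i, hi, x, rfl | ⟨m, hm, rfl⟩, rfl⟩ | ⟨i, hi, rfl⟩)
      · obtain rfl : i = last hn := Fin.ext hi
        exact Or.inl rfl
      · obtain rfl : i = last hn := Fin.ext hi
        exact Or.inr ⟨m + (n - 1), by omega, (pos_add hn m).symm⟩
      · exact Or.inr ⟨i, by omega, (pos_val hn (by omega)).symm⟩
    · rintro (rfl | ⟨m, hm, rfl⟩)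
      · exact Or.inl ⟨last hn, rfl, _, Or.inl rfl, rfl⟩
      · rcases lt_or_ge m (n - 1) with h | h
        · exact Or.inr ⟨⟨m, by omega⟩, h.ne, pos_of_lt hn h⟩
        · obtain ⟨l, rfl⟩ := Nat.exists_eq_add_of_le' h
          exact Or.inl ⟨last hn, rfl, _, Or.inr ⟨l, by omega, rfl⟩, pos_add hn l⟩

/-- Every tree is a forest that hangs off the right spine. -/
theorem exists_forest (hn : 2 ≤ n) (T : NTree n) : ∃ (F : List (NTree n)) (s : ℕ),
    F.length = (n - 1) * s ∧ forestCarets F + s = T.carets ∧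
      ∀ u ∈ T.leaves, u = spine hn s ∨
        ∃ p t, F[p]? = some t ∧ ∃ w ∈ t.leaves, u = pos hn p ++ w := by
  induction T with
  | leaf => exact ⟨[], 0, by simp, by simp [forestCarets, NTree.carets],
      by simp [NTree.leaves, spine]⟩
  | node c ih =>
    obtain ⟨F, s, hl, hc, hu⟩ := ih (last hn)
    have hlen : (List.ofFn fun i : Fin (n - 1) => c ⟨i, by omega⟩).length = n - 1 := by simp
    refine ⟨(List.ofFn fun i : Fin (n - 1) => c ⟨i, by omega⟩) ++ F, s + 1, ?_, ?_, ?_⟩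
    · rw [List.length_append, hlen, hl, mul_add]; omega
    · rw [forestCarets_append, NTree.carets, forestCarets, List.map_ofFn, List.sum_ofFn]
      obtain ⟨m, rfl⟩ : ∃ m, n = m + 1 := ⟨n - 1, by omega⟩
      rw [Fin.sum_univ_castSucc]
      have e : (c (Fin.last m)).carets = forestCarets F + s := hc.symm
      rw [e]
      have e' : ∑ i : Fin (m + 1 - 1), (NTree.carets ∘ fun i : Fin (m + 1 - 1) =>
          c ⟨i, by omega⟩) i = ∑ i : Fin m, (c i.castSucc).carets := rfl
      rw [e']
      omega
    · intro u h
      obtain ⟨i, x, hx, rfl⟩ := NTree.mem_leaves_node.1 h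
      rcases lt_or_ge i.val (n - 1) with hi | hi
      · refine Or.inr ⟨i, c i, ?_, x, hx, by rw [pos_val hn hi]; rfl⟩
        rw [List.getElem?_append_left (by simpa using hi), List.getElem?_ofFn, dif_pos hi]
      · obtain rfl : i = last hn := Fin.ext (by simp [last]; omega)
        rcases hu x hx with rfl | ⟨p, t, hp, w, hw, rfl⟩
        · exact Or.inl rfl
        · refine Or.inr ⟨p + (n - 1), t, ?_, w, hw, by rw [pos_add]; rfl⟩
          rw [List.getElem?_append_right (by simp)]
          simpa using hp

/-- A tree with `N` carets is taken to the comb with `N` carets by an element of length at most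
`3 * N` that fixes `0`: of its letters, at most `N` expand carets and at most `2 * N` are `x_0^{±1}`
from the conjugations. -/
theorem exists_takesSubdivision_comb (hn : 2 ≤ n) (T : NTree n) : ∃ g : ThompsonT n hn,
    Reach (generatorsT n hn) (3 * T.carets) g ∧
      TakesSubdivision (g : UCircle ≃ₜ UCircle) T (comb n T.carets) ∧
        (g : UCircle ≃ₜ UCircle) 0 = 0 := by
  obtain ⟨F, s, hl, hc, hu⟩ := exists_forest hn T
  obtain ⟨g, hg, k, hk, hle⟩ := exists_straightens hn _ F 0 rfl
  have hN : F.length + (n - 1) * forestCarets F = (n - 1) * T.carets := by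
    rw [hl, ← hc, mul_add, add_comm]
  have hQ : ((n - 1) * T.carets - 1) / (n - 1) ≤ T.carets :=
    (Nat.div_le_div_right (Nat.sub_le _ 1)).trans (by
      rw [Nat.mul_div_cancel_left _ (by omega : 0 < n - 1)])
  rw [zero_add, hN] at hle
  refine ⟨g, (?_ : Reach _ k g).mono ?_, takesSubdivision_of_forall hn (carets_comb hn _).symm ?_,
    hg.zero⟩
  · simpa using hk
  · have : (0 - 1) / (n - 1) = 0 := by simp
    omega
  · intro u h
    rcases hu u h with rfl | ⟨p, t, hp, w, hw, rfl⟩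
    · refine ⟨spine hn (s + forestCarets F), (mem_leaves_comb hn _).2 (Or.inl ?_),
        hg.spine s (by omega)⟩
      rw [← hc, add_comm]
    · obtain ⟨m, hm, h⟩ := hg.leaf p t hp w hw
      exact ⟨_, (mem_leaves_comb hn _).2 (Or.inr ⟨m, by omega, rfl⟩), by simpa using h⟩

/-! ### Rotations of the comb -/

/-- The comb with `q` carets along the left edge. -/
def leftComb (n : ℕ) : ℕ → NTree n
  | 0 => .leaf
  | q + 1 => .hang 0 (leftComb n q)

theorem carets_leftComb (hn : 2 ≤ n) (q : ℕ) : (leftComb n q).carets = q := by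
  induction q with
  | zero => rfl
  | succ q ih => rw [leftComb, NTree.carets_hang (by omega), ih, add_comm]

/-- A root caret with a left comb with `q` carets at its first leaf and a right comb with `p`
carets at its last leaf: the image of the right comb with `q + p + 1` carets under `x_0⁻¹ ^ q`. -/
def bicomb (n q p : ℕ) : NTree n :=
  .node fun i => if i.val = 0 then leftComb n q else if i.val = n - 1 then comb n p else .leaf

theorem mem_leaves_bicomb (hn : 2 ≤ n) {q p : ℕ} {w : List (Fin n)} :
    w ∈ (bicomb n q p).leaves ↔ (∃ x ∈ (leftComb n q).leaves, w = ⟨0, by omega⟩ :: x) ∨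
      (∃ x ∈ (comb n p).leaves, w = last hn :: x) ∨
      ∃ i : Fin n, i.val ≠ 0 ∧ i.val ≠ n - 1 ∧ w = [i] := by
  rw [bicomb, NTree.mem_leaves_node]
  constructor
  · rintro ⟨i, x, hx, rfl⟩
    by_cases h : i.val = 0
    · rw [if_pos h] at hx
      exact Or.inl ⟨x, hx, by congr 1; exact Fin.ext h⟩
    by_cases h' : i.val = n - 1
    · rw [if_neg h, if_pos h'] at hx
      exact Or.inr (Or.inl ⟨x, hx, by congr 1; exact Fin.ext h'⟩)
    · rw [if_neg h, if_neg h', NTree.leaves, List.mem_singleton] at hx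
      exact Or.inr (Or.inr ⟨i, h, h', by rw [hx]⟩)
  · rintro (⟨x, hx, rfl⟩ | ⟨x, hx, rfl⟩ | ⟨i, h, h', rfl⟩)
    · exact ⟨_, x, by simpa using hx, rfl⟩
    · exact ⟨_, x, by simpa [last, show n - 1 ≠ 0 by omega] using hx, rfl⟩
    · exact ⟨i, [], by simp [h, h', NTree.leaves], rfl⟩

theorem carets_bicomb (hn : 2 ≤ n) (q p : ℕ) : (bicomb n q p).carets = q + p + 1 := by
  have h : ∀ i : Fin n, (if i.val = 0 then leftComb n q else if i.val = n - 1 then comb n p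
      else .leaf).carets
      = (if i = ⟨0, by omega⟩ then q else 0) + if i = last hn then p else 0 := by
    intro i
    simp only [Fin.ext_iff, last]
    split_ifs <;> first | omega | simp [carets_leftComb hn, carets_comb hn, NTree.carets]
  simp [bicomb, NTree.carets, h, Finset.sum_add_distrib]
  omega

theorem bicomb_zero (hn : 2 ≤ n) (p : ℕ) : bicomb n 0 p = comb n (p + 1) := by
  rw [bicomb, comb, NTree.hang]
  congr 1
  funext i
  by_cases h : i.val = 0
  · rw [if_pos h, if_neg (by omega)]; rfl
  · rw [if_neg h]

theorem takesSubdivision_bicomb (hn : 2 ≤ n) (q p : ℕ) :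
    TakesSubdivision (xHomeo hn 0) (bicomb n (q + 1) p) (bicomb n q (p + 1)) := by
  refine takesSubdivision_of_forall hn (by rw [carets_bicomb hn, carets_bicomb hn]; omega) ?_
  intro u hu
  have h0 : 0 < n := by omega
  simp only [mem_leaves_bicomb hn]
  have hcomb : ∀ i : Fin n, i.val < n - 1 → [i] ∈ (comb n (p + 1)).leaves := fun i hi =>
    mem_leaves_hang.2 (Or.inr ⟨i, hi.ne, rfl⟩)
  rcases (mem_leaves_bicomb hn).1 hu with ⟨x, hx, rfl⟩ | ⟨x, hx, rfl⟩ | ⟨i, h, h', rfl⟩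
  · rcases mem_leaves_hang.1 hx with ⟨i, hi, y, hy, rfl⟩ | ⟨i, hi, rfl⟩
    · obtain rfl : i = ⟨0, h0⟩ := Fin.ext hi
      exact ⟨_, Or.inl ⟨y, hy, rfl⟩,
        (xHomeo_at_left hn (by omega) (zero_add _) (by simp; omega)).append y⟩
    · rcases lt_or_ge i.val (n - 1) with h | h
      · exact ⟨_, Or.inr (Or.inr ⟨i, hi, h.ne, rfl⟩),
          xHomeo_at_left hn (by omega) (zero_add _) h⟩
      · exact ⟨_, Or.inr (Or.inl ⟨[⟨0, by omega⟩], hcomb _ (by simp; omega), rfl⟩),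
          xHomeo_at_right hn (by omega) (by simp; omega)⟩
  · exact ⟨_, Or.inr (Or.inl ⟨last hn :: x, mem_leaves_hang.2 (Or.inl ⟨_, rfl, x, hx, rfl⟩), rfl⟩),
      (xHomeo_gt hn (by omega) (m := last hn) (by simp [last]; omega)).append x⟩
  · exact ⟨_, Or.inr (Or.inl ⟨[i], hcomb i (by omega), rfl⟩), xHomeo_gt hn (by omega) (by omega)⟩

theorem takesSubdivision_pow_bicomb (hn : 2 ≤ n) (q p : ℕ) :
    TakesSubdivision (xHomeo hn 0 ^ q) (bicomb n q p) (bicomb n 0 (p + q)) := by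
  induction q generalizing p with
  | zero => exact takesSubdivision_one _
  | succ q ih =>
    rw [pow_succ]
    have := (ih (p + 1)).comp (takesSubdivision_bicomb hn q p)
    rwa [show p + 1 + q = p + (q + 1) by omega] at this

theorem mapsAffinely_pow_pos (hn : 2 ≤ n) (q : ℕ) {r : ℕ} (hr : 0 < r) :
    MapsAffinely (xHomeo hn 0 ^ q) (pos hn r) (pos hn (r + (n - 1) * q)) := by
  induction q with
  | zero => exact mapsAffinely_one _
  | succ q ih =>
    rw [pow_succ', mul_add, mul_one, ← add_assoc]
    exact ih.comp ((expands_xHomeo hn (Nat.zero_le _)).gt _ (by omega))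

theorem exists_takesSubdivision_pow_cHomeo (hn : 2 ≤ n) (r : ℕ) (c : Fin n → NTree n) :
    ∃ U : NTree n, TakesSubdivision (cHomeo n ^ r) (.node c) U := by
  suffices h : ∃ c' : Fin n → NTree n, TakesSubdivision (cHomeo n ^ r) (.node c) (.node c') from
    h.imp' _ fun _ => id
  induction r with
  | zero => exact ⟨c, takesSubdivision_one _⟩
  | succ r ih =>
    obtain ⟨c', h⟩ := ih
    exact ⟨_, by rw [pow_succ']; exact (takesSubdivision_cHomeo hn c').comp h⟩

theorem cHomeo_pow_coe (r : ℕ) (x : ℝ) :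
    (cHomeo n ^ r) (x : UCircle) = ((x - r / n : ℝ) : UCircle) := by
  induction r with
  | zero => simp
  | succ r ih =>
    rw [pow_succ', Homeomorph.mul_apply, ih, cHomeo_coe]
    congr 1
    push_cast
    ring

theorem leftEnd_pos_of_le (hn : 2 ≤ n) {r : ℕ} (hr : r ≤ n - 1) :
    leftEnd (pos hn r) = (r : ℝ) / n := by
  rcases hr.lt_or_eq with h | rfl
  · rw [pos_of_lt hn h]
    simp [leftEnd]
  · have h := pos_add hn 0
    rw [zero_add, pos_of_lt hn (m := 0) (by omega)] at h
    rw [h]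
    simp [leftEnd, last]

/-- Every left end point of a leaf of the comb with `N` carets can be moved to `0` by an element of
length at most `N + (n - 1)` that takes the comb to a tree with equally many carets: a power of
`x_0⁻¹` moves the point to a leaf of the root caret, and then a power of `c_0` moves it to `0`. -/
theorem exists_move_to_zero (hn : 2 ≤ n) {N k : ℕ} (hk : k ≤ (n - 1) * N) :
    ∃ (h : ThompsonT n hn) (U : NTree n), Reach (generatorsT n hn) (N + (n - 1)) h ∧
      TakesSubdivision (h : UCircle ≃ₜ UCircle) (comb n N) U ∧
      (h : UCircle ≃ₜ UCircle) (leftEnd (pos hn k) : UCircle) = 0 := by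
  rcases Nat.eq_zero_or_pos k with rfl | hk0
  · refine ⟨1, comb n N, Reach.one.mono (Nat.zero_le _), takesSubdivision_one _, ?_⟩
    rw [leftEnd_pos_of_le hn (Nat.zero_le _)]
    simp
  have h0 : 0 < n - 1 := by omega
  have hdm := Nat.div_add_mod (k - 1) (n - 1)
  have hm := Nat.mod_lt (k - 1) h0
  have hq : (k - 1) / (n - 1) < N := by
    rw [Nat.div_lt_iff_lt_mul h0, mul_comm]; omega
  -- Write `k = r + (n - 1) q` with `1 ≤ r ≤ n - 1`, so that `x_0⁻¹ ^ q` moves the point to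
  -- `r / n`; the variable `r` below is one less.
  generalize (k - 1) / (n - 1) = q at hdm hq
  generalize (k - 1) % (n - 1) = r at hdm hm
  obtain ⟨p, rfl⟩ : ∃ p, N = p + q + 1 := ⟨N - q - 1, by omega⟩
  obtain rfl : k = (r + 1) + (n - 1) * q := by omega
  have h1 := (takesSubdivision_pow_bicomb hn q p).symm
  rw [bicomb_zero hn] at h1
  obtain ⟨U, h2⟩ := exists_takesSubdivision_pow_cHomeo hn (r + 1) fun i : Fin n =>
    if i.val = 0 then leftComb n q else if i.val = n - 1 then comb n p else .leaf
  refine ⟨cElt hn ^ (r + 1) * (xZero hn ^ q)⁻¹, U, ?_, h2.comp h1, ?_⟩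
  · refine (((Reach.of_mem (cElt_mem hn)).pow (r + 1)).mul
      ((Reach.of_mem (xElt_mem hn _)).pow q).inv).mono ?_
    omega
  · have h3 := (mapsAffinely_pow_pos hn q (Nat.succ_pos r)).symm.leftEnd
    have h4 : ((xHomeo hn 0 ^ q)⁻¹ : UCircle ≃ₜ UCircle)
        (leftEnd (pos hn (r + 1 + (n - 1) * q)) : UCircle) = ((r + 1 : ℕ) / n : ℝ) := by
      rw [h3, leftEnd_pos_of_le hn (by omega)]
    change (cHomeo n ^ (r + 1)) (((xHomeo hn 0 ^ q)⁻¹ : UCircle ≃ₜ UCircle) _) = 0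
    rw [h4, cHomeo_pow_coe, sub_self]
    rfl

/-! ### The upper bound -/

/-- The last leaf of the comb starts where position `(n - 1) * N` does. -/
theorem exists_pos_of_mem_leaves_comb (hn : 2 ≤ n) {N : ℕ} {v : List (Fin n)}
    (hv : v ∈ (comb n N).leaves) : ∃ k ≤ (n - 1) * N, leftEnd v = leftEnd (pos hn k) := by
  rcases (mem_leaves_comb hn N).1 hv with rfl | ⟨m, hm, rfl⟩
  · refine ⟨(n - 1) * N, le_rfl, ?_⟩
    have h0 : 0 < n - 1 := by omega
    simp [pos, Nat.mul_div_cancel_left _ h0, leftEnd_append, leftEnd]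
  · exact ⟨m, hm.le, rfl⟩

/-- With straightenings `a`, `b`, `d` of the source, the target and an intermediate tree, and an
element `m` that moves the image of `0` back to `0`, the product `d m b ω a⁻¹` fixes `0` and takes
the comb to itself. -/
theorem reach_of_takesSubdivision (hn : 2 ≤ n) {ω : ThompsonT n hn} {T S : NTree n}
    (h : TakesSubdivision (ω : UCircle ≃ₜ UCircle) T S) :
    Reach (generatorsT n hn) (10 * T.carets + (n - 1)) ω := by
  have hTS := carets_eq_of_length_eq hn (h.length_eq hn)
  obtain ⟨a, ha, hTa, ha0⟩ := exists_takesSubdivision_comb hn T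
  obtain ⟨b, hb, hSb, -⟩ := exists_takesSubdivision_comb hn S
  rw [← hTS] at hb hSb
  have hf := hSb.comp h
  obtain ⟨v, hv, hf0⟩ := hf.exists_leaf_zero hn
  obtain ⟨k, hk, hvk⟩ := exists_pos_of_mem_leaves_comb hn hv
  obtain ⟨m, U, hm, hU, hm0⟩ := exists_move_to_zero hn hk
  have hUc : U.carets = T.carets := by
    rw [← carets_eq_of_length_eq hn (hU.length_eq hn), carets_comb hn]
  obtain ⟨d, hd, hUd, hd0⟩ := exists_takesSubdivision_comb hn U
  rw [hUc] at hd hUd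
  have h1 : d * (m * (b * ω)) * a⁻¹ = 1 := by
    apply Subtype.ext
    refine ((hUd.comp (hU.comp hf)).comp hTa.symm).eq_one hn ?_
    simp only [Homeomorph.mul_apply] at hf0 ⊢
    rw [inv_zero_of_zero ha0, hf0, hvk, hm0, hd0]
  have h2 : ω = b⁻¹ * (m⁻¹ * (d⁻¹ * a)) := by
    rw [mul_inv_eq_one] at h1
    rw [← h1]
    group
  rw [h2]
  exact (hb.inv.mul (hm.inv.mul (hd.inv.mul ha))).mono (by omega)

/-! ### The lower bound -/

theorem carets_graft_sub_le (s t : NTree n) : (s.graft t.sub).carets ≤ s.carets + t.carets := by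
  induction s generalizing t with
  | leaf => simp [NTree.graft, NTree.sub_nil, NTree.carets]
  | node c ih =>
    cases t with
    | leaf =>
      have h : ∀ i, ((c i).graft fun w => (NTree.leaf : NTree n).sub (i :: w)).carets
          ≤ (c i).carets := by
        intro i
        have h := ih i .leaf
        have e : (fun w => (NTree.leaf : NTree n).sub (i :: w)) = (NTree.leaf : NTree n).sub :=
          funext fun w => by rw [NTree.sub_leaf, NTree.sub_leaf]
        rw [e]
        simpa [NTree.carets] using h
      have := Finset.sum_le_sum fun i (_ : i ∈ Finset.univ) => h i
      simp only [NTree.graft, NTree.carets]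
      omega
    | node d =>
      have := Finset.sum_le_sum fun i (_ : i ∈ Finset.univ) => ih i (d i)
      rw [Finset.sum_add_distrib] at this
      change 1 + ∑ i, ((c i).graft (d i).sub).carets ≤ _
      simp only [NTree.carets]
      omega

/-- The number of carets is subadditive under composition. -/
theorem exists_takesSubdivision_mul (hn : 2 ≤ n) {f g : UCircle ≃ₜ UCircle} {T S U V : NTree n}
    (hf : TakesSubdivision f T S) (hg : TakesSubdivision g U V) :
    ∃ T' V' : NTree n, TakesSubdivision (g * f) T' V' ∧ T'.carets ≤ T.carets + U.carets := by
  obtain ⟨T', hT⟩ := hf.expand hn U.sub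
  obtain ⟨V', hV⟩ := hg.symm.expand hn S.sub
  have hV' := hV.symm
  rw [inv_inv, ← NTree.graft_sub_comm] at hV'
  refine ⟨T', V', hV'.comp hT, ?_⟩
  rw [carets_eq_of_length_eq hn (hT.length_eq hn), carets_eq_of_length_eq hn (hf.length_eq hn)]
  exact carets_graft_sub_le S U

theorem carets_source_x_le (hn : 2 ≤ n) (i : Fin n) : (TreePair.x hn i).source.carets ≤ 3 := by
  have h0 : 0 < n := by omega
  have h1 : n - 1 < n := by omega
  simp only [TreePair.x]
  split_ifs <;> simp [NTree.carets_hang, NTree.carets_caret, h0, h1]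

theorem exists_takesSubdivision_of_mem (hn : 2 ≤ n) {g : ThompsonT n hn}
    (hg : g ∈ generatorsT n hn) :
    ∃ T S : NTree n, TakesSubdivision (g : UCircle ≃ₜ UCircle) T S ∧ T.carets ≤ 3 := by
  rcases hg with ⟨i, hg⟩ | hg
  · exact ⟨_, _, hg.takesSubdivision, carets_source_x_le hn i⟩
  · exact ⟨_, _, hg.takesSubdivision, by simp [TreePair.c₀, NTree.carets_caret]⟩

theorem exists_takesSubdivision_of_reach (hn : 2 ≤ n) {g : ThompsonT n hn} {k : ℕ}
    (hg : Reach (generatorsT n hn) k g) :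
    ∃ T S : NTree n, TakesSubdivision (g : UCircle ≃ₜ UCircle) T S ∧ T.carets ≤ 3 * k := by
  obtain ⟨l, hl, rfl, hk⟩ := hg
  induction l generalizing k with
  | nil => exact ⟨.leaf, .leaf, takesSubdivision_one _, by simp [NTree.carets]⟩
  | cons s l ih =>
    obtain ⟨T, S, h1, h2⟩ := ih (fun s hs => hl s (by simp [hs])) le_rfl
    obtain ⟨U, V, h3, h4⟩ : ∃ T S : NTree n, TakesSubdivision (s : UCircle ≃ₜ UCircle) T S
        ∧ T.carets ≤ 3 := by
      rcases hl s (by simp) with h | h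
      · exact exists_takesSubdivision_of_mem hn h
      · obtain ⟨U, V, h3, h4⟩ := exists_takesSubdivision_of_mem hn h
        have h5 := h3.symm
        rw [Subgroup.coe_inv, inv_inv] at h5
        exact ⟨V, U, h5, by rwa [carets_eq_of_length_eq hn (h5.length_eq hn)]⟩
    obtain ⟨T', V', h5, h6⟩ := exists_takesSubdivision_mul hn h1 h3
    refine ⟨T', V', by simpa using h5, ?_⟩
    rw [List.length_cons] at hk
    omega

/-- A tree whose leaves all lie below leaves of `S` has at least as many carets as `S`. -/
theorem carets_le_of_prefix {T S : NTree n} (h : ∀ w ∈ T.leaves, ∃ u ∈ S.leaves, u <+: w) :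
    S.carets ≤ T.carets := by
  induction S generalizing T with
  | leaf => exact Nat.zero_le _
  | node c ih =>
    cases T with
    | leaf =>
      obtain ⟨u, hu, h⟩ := h [] (by simp [NTree.leaves])
      obtain ⟨i, x, -, rfl⟩ := NTree.mem_leaves_node.1 hu
      simp at h
    | node d =>
      refine Nat.add_le_add_left (Finset.sum_le_sum fun i _ => ih i fun w hw => ?_) 1
      obtain ⟨u, hu, h⟩ := h (i :: w) (NTree.mem_leaves_node.2 ⟨i, w, hw, rfl⟩)
      obtain ⟨j, x, hx, rfl⟩ := NTree.mem_leaves_node.1 hu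
      obtain ⟨rfl, hxw⟩ := List.cons_prefix_cons.1 h
      exact ⟨x, hx, hxw⟩

theorem exists_forall_append_mem_leaves (c : Fin n → NTree n) :
    ∃ x : List (Fin n), ∀ j : Fin n, x ++ [j] ∈ (NTree.node c).leaves := by
  suffices h : ∀ S : NTree n, S ≠ .leaf → ∃ x : List (Fin n), ∀ j : Fin n, x ++ [j] ∈ S.leaves from
    h _ (by simp)
  intro S
  induction S with
  | leaf => intro h; exact absurd rfl h
  | node c ih =>
    intro _
    by_cases h : ∃ i, c i ≠ .leaf
    · obtain ⟨i, hi⟩ := h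
      obtain ⟨x, hx⟩ := ih i hi
      exact ⟨i :: x, fun j => NTree.mem_leaves_node.2 ⟨i, _, hx j, rfl⟩⟩
    · push Not at h
      exact ⟨[], fun j => NTree.mem_leaves_node.2 ⟨j, [], by simp [h, NTree.leaves], rfl⟩⟩

/-- An address lies below a leaf of `S`, or above a caret of `S` that ends in leaves. -/
theorem exists_prefix_or_caret (S : NTree n) (w : List (Fin n)) :
    (∃ u ∈ S.leaves, u <+: w) ∨ ∃ x : List (Fin n), ∀ j : Fin n, w ++ x ++ [j] ∈ S.leaves := by
  induction S generalizing w with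
  | leaf => exact Or.inl ⟨[], by simp [NTree.leaves], List.nil_prefix⟩
  | node c ih =>
    cases w with
    | nil => exact Or.inr (exists_forall_append_mem_leaves c)
    | cons i w =>
      rcases ih i w with ⟨u, hu, h⟩ | ⟨x, hx⟩
      · exact Or.inl ⟨i :: u, NTree.mem_leaves_node.2 ⟨i, u, hu, rfl⟩,
          List.cons_prefix_cons.2 ⟨rfl, h⟩⟩
      · exact Or.inr ⟨x, fun j => NTree.mem_leaves_node.2 ⟨i, _, hx j, rfl⟩⟩

/-- A reduced tree pair has the least number of carets: if the homeomorphism were affine on the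
interval of an inner vertex of the source, then also on that of a caret below it that ends in
leaves, and this caret could be removed. -/
theorem carets_le_of_isReduced (hn : 2 ≤ n) {P : TreePair n} {f : UCircle ≃ₜ UCircle}
    (hP : P.Represents f) (hr : P.IsReduced) {T S : NTree n} (h : TakesSubdivision f T S) :
    P.carets ≤ T.carets := by
  refine carets_le_of_prefix fun w hw => ?_
  rcases exists_prefix_or_caret P.source w with h1 | ⟨x, hx⟩
  · exact h1
  · obtain ⟨v, -, hv⟩ := h.1 w hw
    refine absurd ⟨w ++ x, v ++ x, fun j => ?_⟩ hr
    obtain ⟨y, -, hy⟩ := exists_matching_left P (hx j)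
    have := (hP _ hy).target_unique hn ((hv.append x).append [j])
    simp only at this
    rwa [this] at hy

/-! ### Existence of reduced tree pairs -/

theorem eq_leaf_of_nil_mem {t : NTree n} (h : [] ∈ t.leaves) : t = .leaf := by
  cases t with
  | leaf => rfl
  | node c =>
    obtain ⟨i, x, -, h⟩ := NTree.mem_leaves_node.1 h
    simp at h

/-- A caret whose edges all end in leaves can be removed from a tree. -/
theorem exists_remove_caret (hn : 2 ≤ n) (T : NTree n) (u : List (Fin n))
    (h : ∀ j : Fin n, u ++ [j] ∈ T.leaves) : ∃ T' : NTree n, T'.carets + 1 = T.carets ∧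
      ∀ w, w ∈ T'.leaves ↔ w = u ∨ (w ∈ T.leaves ∧ ∀ j, w ≠ u ++ [j]) := by
  classical
  induction T generalizing u with
  | leaf => simpa [NTree.leaves] using h (last hn)
  | node c ih =>
    cases u with
    | nil =>
      have hc : ∀ j, c j = .leaf := by
        intro j
        obtain ⟨i, x, hx, e⟩ := NTree.mem_leaves_node.1 (h j)
        obtain ⟨rfl, rfl⟩ : j = i ∧ [] = x := by simpa using e
        exact eq_leaf_of_nil_mem hx
      refine ⟨.leaf, by simp [NTree.carets, hc], fun w => ?_⟩
      constructor
      · intro hw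
        exact Or.inl (by simpa [NTree.leaves] using hw)
      · rintro (rfl | ⟨hw, hne⟩)
        · simp [NTree.leaves]
        · obtain ⟨i, x, hx, rfl⟩ := NTree.mem_leaves_node.1 hw
          rw [hc, NTree.leaves, List.mem_singleton] at hx
          exact absurd (by rw [hx]; rfl) (hne i)
    | cons i u =>
      obtain ⟨t, ht, hl⟩ := ih i u fun j => by
        obtain ⟨k, x, hx, e⟩ := NTree.mem_leaves_node.1 (h j)
        obtain ⟨rfl, rfl⟩ : i = k ∧ u ++ [j] = x := by simpa using e
        exact hx
      refine ⟨.node (Function.update c i t), ?_, fun w => ?_⟩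
      · have e : ∀ k, (Function.update c i t k).carets
            = Function.update (fun k => (c k).carets) i t.carets k := by
          intro k
          by_cases hk : k = i
          · subst hk; simp
          · simp [hk]
        have h1 := Finset.add_sum_erase Finset.univ (fun k => (c k).carets) (Finset.mem_univ i)
        simp only [NTree.carets, e]
        rw [Finset.sum_update_of_mem (Finset.mem_univ i), Finset.sdiff_singleton_eq_erase]
        omega
      · simp only [NTree.mem_leaves_node]
        constructor
        · rintro ⟨k, x, hx, rfl⟩
          by_cases hk : k = i
          · subst hk
            rw [Function.update_self] at hx
            rcases (hl x).1 hx with rfl | ⟨hx, hne⟩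
            · exact Or.inl rfl
            · exact Or.inr ⟨⟨k, x, hx, rfl⟩, fun j e => hne j (by simpa using e)⟩
          · rw [Function.update_of_ne hk] at hx
            exact Or.inr ⟨⟨k, x, hx, rfl⟩, fun j e => hk (by simp at e; exact e.1)⟩
        · rintro (rfl | ⟨⟨k, x, hx, rfl⟩, hne⟩)
          · exact ⟨i, u, by rw [Function.update_self]; exact (hl u).2 (Or.inl rfl), rfl⟩
          · by_cases hk : k = i
            · subst hk
              refine ⟨k, x, ?_, rfl⟩
              rw [Function.update_self]
              exact (hl x).2 (Or.inr ⟨hx, fun j e => hne j (by rw [e]; rfl)⟩)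
            · exact ⟨k, x, by rwa [Function.update_of_ne hk], rfl⟩

/-- A tree pair with the least number of carets is reduced. -/
theorem exists_isReduced (hn : 2 ≤ n) (ω : ThompsonT n hn) :
    ∃ P : TreePair n, P.Represents ω ∧ P.IsReduced := by
  classical
  have hex : ∃ m, ∃ T S : NTree n, TakesSubdivision (ω : UCircle ≃ₜ UCircle) T S ∧
      T.carets = m := by
    obtain ⟨T, S, h⟩ := ω.2
    exact ⟨_, T, S, h, rfl⟩
  obtain ⟨T, S, h, hm⟩ := Nat.find_spec hex
  obtain ⟨P, rfl, rfl, hP⟩ := exists_represents hn h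
  refine ⟨P, hP, ?_⟩
  rintro ⟨u, v, huv⟩
  have hu : ∀ j, u ++ [j] ∈ P.source.leaves := fun j => (List.of_mem_zip (huv j)).1
  have hv : ∀ j, v ++ [j] ∈ P.target.leaves := fun j =>
    List.mem_rotate.1 (List.of_mem_zip (huv j)).2
  obtain ⟨T', hT, hT'⟩ := exists_remove_caret hn _ u hu
  obtain ⟨S', hS, hS'⟩ := exists_remove_caret hn _ v hv
  have hc := carets_eq_of_length_eq hn P.length_eq
  refine Nat.find_min hex (m := T'.carets) (by omega)
    ⟨T', S', takesSubdivision_of_forall hn (by omega) fun w hw => ?_, rfl⟩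
  rcases (hT' w).1 hw with rfl | ⟨hw, hne⟩
  · refine ⟨v, (hS' v).2 (Or.inl rfl), mapsAffinely_of_forall_leaf hn (.caret n) fun x hx => ?_⟩
    obtain ⟨j, rfl⟩ := mem_leaves_caret.1 hx
    exact hP _ (huv j)
  · obtain ⟨y, hy, hwy⟩ := h.1 w hw
    refine ⟨y, (hS' y).2 (Or.inr ⟨hy, ?_⟩), hwy⟩
    rintro j rfl
    exact hne j (hwy.source_unique hn (hP _ (huv j)))

end ThompsonMetric

open ThompsonMetric

theorem mainTheorem4 (n : ℕ) (hn : 2 ≤ n) :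
    Subgroup.closure (generatorsT n hn) = ⊤ ∧
    ∀ ω : ThompsonT n hn,
      (∃ P : TreePair n, P.Represents ω ∧ P.IsReduced) ∧
      ∀ P : TreePair n, P.Represents ω → P.IsReduced →
        (P.carets : ℝ) / 3 ≤ (wordLength (generatorsT n hn) ω : ℝ) ∧
        (wordLength (generatorsT n hn) ω : ℝ) ≤ 15 * ((n : ℝ) - 1) * (P.carets : ℝ) + 3 * n := by
  refine ⟨?_, fun ω => ⟨exists_isReduced hn ω, fun P hP hr => ?_⟩⟩
  · rw [eq_top_iff]
    intro ω _
    obtain ⟨T, S, h⟩ := ω.2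
    exact (reach_of_takesSubdivision hn h).mem_closure
  · have hreach := reach_of_takesSubdivision hn hP.takesSubdivision
    constructor
    · obtain ⟨T, S, h, hc⟩ := exists_takesSubdivision_of_reach hn hreach.reach_wordLength
      have h1 : (P.carets : ℝ) ≤ 3 * wordLength (generatorsT n hn) ω := by
        exact_mod_cast (carets_le_of_isReduced hn hP hr h).trans hc
      linarith
    · have h1 : (wordLength (generatorsT n hn) ω : ℝ) ≤ ((10 * P.carets + (n - 1) : ℕ) : ℝ) :=
        Nat.cast_le.2 hreach.wordLength_le
      push_cast [Nat.cast_sub (show 1 ≤ n by omega)] at h1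
      have h2 : (2 : ℝ) ≤ n := by exact_mod_cast hn
      have h3 : 1 * (P.carets : ℝ) ≤ (n - 1) * P.carets :=
        mul_le_mul_of_nonneg_right (by linarith) (Nat.cast_nonneg _)
      have h4 : (0 : ℝ) ≤ P.carets := Nat.cast_nonneg _
      linarith
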